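/- Let $M$ be a smooth $n$-manifold ($n\ge 2$, possibly with boundary) with a time-independent Riemannian metric $g$ with Levi-Civita connection $\nabla$, and a time-independent volume form $\mu$. An ideal incompressible fluid is a time-dependent vector field $v$ (parallel to $\partial M$) and pressure $p$, smooth for times $t$ in an open set $J\subseteq\mathbb R$, with $$\frac{\partial v}{\partial t}+\nabla_v v=-(\mathrm dp)^\sharp,\qquad \mathrm d\,\iota_v\mu=0 .$$ It is an Aristotelian fluid if in addition there is a smooth one-parameter family of one-forms $\tau$, symmetric tensors $h\in\Gamma(\odot^2T^*M)$ and $\gamma\in\Gamma(\odot^2TM)$ with $\iota_v\tau=1$, $\iota_vh=0$, $\iota_\tau\gamma=0$, such that $\ker\tau$ is $g$-orthogonal to $v$, $h=g$ on $\ker\tau$, $\gamma=g^{-1}$ on $\mathrm{Ann}(v)$, and $\mathrm d\tau=\tau\wedge\alpha'$ for some one-form $\alpha'$. Write $v^\flat=\iota_vg$, $s_v=g(v,v)>0$ (the squared speed), let the vorticity $\xi$ be the $(n-2)$-vector field with $\omega_\xi:=\xi\lrcorner\mu=\mathrm dv^\flat$, and put $$\alpha=\pounds_v\tau,\qquad \alpha_v=\alpha-\mathrm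 d\log s_v .$$ The Godbillon-Vey class $\mathtt{GV}(\eta)\in H^3(M;\mathbb R)$ of a nowhere-vanishing one-form $\eta$ with $\mathrm d\eta=\eta\wedge\beta$ for some one-form $\beta$ is the de Rham class of $\beta\wedge\mathrm d\beta$, which does not depend on $\beta$. **Proposition.** For an Aristotelian fluid, at every time $t\in J$: 1. $\mathrm d\tau=\tau\wedge\alpha$ and $\mathrm dv^\flat=v^\flat\wedge\alpha_v$; the form $\alpha_v\wedge\mathrm d\alpha_v$ is closed and $\mathtt{GV}(\tau)=\mathtt{GV}(v^\flat)=[\alpha_v\wedge\mathrm d\alpha_v]$. 2. $$\alpha_v\wedge\mathrm d\alpha_v=-\,\mathrm d\Big(\frac{1}{s_v^{2}}\,(\pounds_vs_v)\,\omega_\xi\Big)-\frac1{s_v^{2}}\,(\iota_v\omega_\xi)\wedge\Big(\frac{\partial\xi}{\partial t}\lrcorner\mu\Big).$$ 3. If $s_v$ is constant along the fluid lines at time $t$, that is $\pounds_vs_v=0$ on $M$, then $$\alpha_v\wedge\mathrm d\alpha_v=-\frac1{s_v^{2}}\,(\iota_v\omega_\xi)\wedge\Big(\frac{\partial\xi}{\partial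 t}\lrcorner\mu\Big);$$ in this case, if $\frac{\partial\xi}{\partial t}=0$ on $M$ at time $t$, then $\mathtt{GV}(\tau)=0$, and likewise if $\frac{\partial v}{\partial t}=0$ on $M$ at time $t$. Thus a non-zero Godbillon-Vey class is an obstruction to a steady fluid flow. -/

import Mathlib

open scoped Manifold ContDiff Topology
open Set Bundle

noncomputable section

namespace AristotelianHydro

/-! ### Algebra on one tangent space

`V` plays the role of `T_x M`. Covectors are turned into alternating maps in one variable so that
all forms live in the spaces `V [⋀^Fin k]→L[ℝ] ℝ`. -/

section Pointwise

variable {V : Type*} [NormedAddCommGroup V] [NormedSpace ℝ V] {k m : ℕ}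

/-- A covector seen as an alternating map in one variable. -/
def ofCovector (a : V →L[ℝ] ℝ) : V [⋀^Fin 1]→L[ℝ] ℝ :=
  ContinuousAlternatingMap.ofSubsingleton ℝ V ℝ 0 a

/-- An alternating map in one variable seen as a covector. -/
def toCovector (a : V [⋀^Fin 1]→L[ℝ] ℝ) : V →L[ℝ] ℝ :=
  (ContinuousAlternatingMap.ofSubsingleton ℝ V ℝ 0).symm a

/-- The exterior product `a ∧ w` of a covector with a `k`-covector:
`(a ∧ w)(v₀, …, v_k) = ∑ i, (-1)^i a(v_i) w(v₀, …, v_{i-1}, v_{i+1}, …, v_k)`. -/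
def wedgePt (a : V [⋀^Fin 1]→L[ℝ] ℝ) (w : V [⋀^Fin k]→L[ℝ] ℝ) : V [⋀^Fin (k + 1)]→L[ℝ] ℝ :=
  ContinuousAlternatingMap.alternatizeUncurryFin ((toCovector a).smulRight w)

theorem append_update_left {A : Type*} (X : Fin k → A) (Y : Fin m → A) (i : Fin k) (a : A) :
    Fin.append (Function.update X i a) Y
      = Function.update (Fin.append X Y) (Fin.castAdd m i) a := by
  ext j
  refine Fin.addCases (fun j => ?_) (fun j => ?_) j
  · by_cases h : j = i
    · subst h; simp
    · have : Fin.castAdd m j ≠ Fin.castAdd m i := fun h' => h (Fin.castAdd_injective _ _ h')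
      simp [Function.update_of_ne h, Function.update_of_ne this]
  · have : Fin.natAdd k j ≠ Fin.castAdd m i := by
      intro h'
      have := congrArg Fin.val h'
      simp at this
      omega
    simp [Function.update_of_ne this]

theorem append_update_right {A : Type*} (X : Fin k → A) (Y : Fin m → A) (i : Fin m) (a : A) :
    Fin.append X (Function.update Y i a)
      = Function.update (Fin.append X Y) (Fin.natAdd k i) a := by
  ext j
  refine Fin.addCases (fun j => ?_) (fun j => ?_) j
  · have : Fin.castAdd m j ≠ Fin.natAdd k i := by
      intro h'
      have := congrArg Fin.val h'
      simp at this
      omega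
    simp [Function.update_of_ne this]
  · by_cases h : j = i
    · subst h; simp
    · have : Fin.natAdd k j ≠ Fin.natAdd k i := fun h' => h (Fin.natAdd_injective _ _ h')
      simp [Function.update_of_ne h, Function.update_of_ne this]

/-- For a fixed `(k + m)`-covector `w`, the alternating map sending `(X₁, …, X_k)` to the
`m`-covector `(Y₁, …, Y_m) ↦ w(X₁, …, X_k, Y₁, …, Y_m)`. -/
def contractAlternating (w : V [⋀^Fin (k + m)]→L[ℝ] ℝ) :
    V [⋀^Fin k]→ₗ[ℝ] (V [⋀^Fin m]→L[ℝ] ℝ) where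
  toFun X :=
    { toFun := fun Y => w (Fin.append X Y)
      map_update_add' := by
        intro inst Y i a b
        rw [Subsingleton.elim inst (instDecidableEqFin m)]
        simp only [append_update_right, ContinuousAlternatingMap.map_update_add]
      map_update_smul' := by
        intro inst Y i c a
        rw [Subsingleton.elim inst (instDecidableEqFin m)]
        simp only [append_update_right, ContinuousAlternatingMap.map_update_smul]
      map_eq_zero_of_eq' := by
        intro Y i j h hij
        exact w.map_eq_zero_of_eq _ (i := Fin.natAdd k i) (j := Fin.natAdd k j) (by simpa using h)
          (fun h' => hij (Fin.natAdd_injective _ _ h'))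
      cont := by
        refine w.cont.comp (continuous_pi fun j => ?_)
        refine Fin.addCases (fun j => ?_) (fun j => ?_) j
        · simpa using continuous_const
        · simpa using continuous_apply j }
  map_update_add' := by
    intro inst X i a b
    rw [Subsingleton.elim inst (instDecidableEqFin k)]
    ext Y
    change w _ = w _ + w _
    simp only [append_update_left, ContinuousAlternatingMap.map_update_add]
  map_update_smul' := by
    intro inst X i c a
    rw [Subsingleton.elim inst (instDecidableEqFin k)]
    ext Y
    change w _ = c • w _
    simp only [append_update_left, ContinuousAlternatingMap.map_update_smul]
  map_eq_zero_of_eq' := by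
    intro X i j h hij
    ext Y
    exact w.map_eq_zero_of_eq _ (i := Fin.castAdd m i) (j := Fin.castAdd m j) (by simpa using h)
      (fun h' => hij (Fin.castAdd_injective _ _ h'))

/-- The contraction `ξ ⌟ w` of a `k`-vector `ξ ∈ ⋀^k V` with a `(k + m)`-covector `w`, the linear
extension of `(X₁ ∧ ⋯ ∧ X_k) ⌟ w = w(X₁, …, X_k, ·, …, ·)`. -/
def contract (ξ : ⋀[ℝ]^k V) (w : V [⋀^Fin (k + m)]→L[ℝ] ℝ) : V [⋀^Fin m]→L[ℝ] ℝ :=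
  exteriorPower.alternatingMapLinearEquiv (contractAlternating w) ξ

end Pointwise

/-! ### Differential forms on a manifold

The tangent space `TangentSpace I x` is by definition the model space `E`, by means of the
preferred chart at `x`. -/

section Forms

variable {E : Type*} [NormedAddCommGroup E] [NormedSpace ℝ E]
  {H : Type*} [TopologicalSpace H] (I : ModelWithCorners ℝ E H)
  {M : Type*} [TopologicalSpace M] [ChartedSpace H M] {k : ℕ}

variable (E M) in
/-- (Not necessarily smooth) differential `k`-forms on `M`. -/
abbrev DForm (k : ℕ) : Type _ := M → E [⋀^Fin k]→L[ℝ] ℝ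

/-- The covector on `T_x M` given by a one-form. -/
def covectorAt (w : DForm E M 1) (x : M) : TangentSpace I x →L[ℝ] ℝ := toCovector (V := E) (w x)

/-- The exterior product of a one-form with a `k`-form. -/
def wedge (α : DForm E M 1) (w : DForm E M k) : DForm E M (k + 1) := fun x => wedgePt (α x) (w x)

/-- The interior product `ι_X w`. -/
def interiorProd (X : (x : M) → TangentSpace I x) (w : DForm E M (k + 1)) : DForm E M k :=
  fun x => (w x).curryLeft (X x)

/-- The differential of a function, as a one-form. -/
def dFun (f : M → ℝ) : DForm E M 1 := fun x => ofCovector (mvfderiv I f x)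

/-- The Lie derivative `£_X f = df(X)` of a function along a vector field. -/
def lieFun (X : (x : M) → TangentSpace I x) (f : M → ℝ) : M → ℝ := fun x => mvfderiv I f x (X x)

variable [IsManifold I ∞ M]

/-- The coordinate expression of a form in the preferred chart at `x₀`, a form on the model space:
the pullback of the form under the inverse of the chart. -/
def inChart (x₀ : M) (w : DForm E M k) : E → E [⋀^Fin k]→L[ℝ] ℝ := fun y =>
  (w ((extChartAt I x₀).symm y)).compContinuousLinearMap
    (tangentCoordChange I x₀ ((extChartAt I x₀).symm y) ((extChartAt I x₀).symm y))

/-- A form is smooth if its coordinate expressions are. -/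
def SmoothForm (w : DForm E M k) : Prop :=
  ∀ x₀ : M, ContDiffOn ℝ ∞ (inChart I x₀ w) (extChartAt I x₀).target

/-- A one-parameter family of forms, with the parameter in `J`, is smooth if its coordinate
expressions are jointly smooth in the parameter and the point. -/
def SmoothFormFamily (J : Set ℝ) (w : ℝ → DForm E M k) : Prop :=
  ∀ x₀ : M, ContDiffOn ℝ ∞ (fun q : ℝ × E => inChart I x₀ (w q.1) q.2)
    (J ×ˢ (extChartAt I x₀).target)

/-- The exterior derivative of a form. At `x` it is computed in the preferred chart at `x`, in which
`T_x M` is identified with `E`; if `M` has a boundary, derivatives are taken within the range of the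
chart. -/
def extD (w : DForm E M k) : DForm E M (k + 1) := fun x =>
  extDerivWithin (inChart I x w) (range I) (extChartAt I x x)

/-- The Lie derivative of a form along a vector field, by the Cartan homotopy formula. -/
def lieForm (X : (x : M) → TangentSpace I x) (w : DForm E M (k + 1)) : DForm E M (k + 1) :=
  extD I (interiorProd I X w) + interiorProd I X (extD I w)

/-! ### De Rham cohomology in positive degree -/

theorem inChart_add (x₀ : M) (w w' : DForm E M k) :
    inChart I x₀ (w + w') = inChart I x₀ w + inChart I x₀ w' := by
  ext; simp [inChart]

theorem inChart_smul (x₀ : M) (c : ℝ) (w : DForm E M k) :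
    inChart I x₀ (c • w) = c • inChart I x₀ w := by
  ext; simp [inChart]

theorem SmoothForm.add {w w' : DForm E M k} (hw : SmoothForm I w) (hw' : SmoothForm I w') :
    SmoothForm I (w + w') := fun x₀ => by
  rw [inChart_add]; exact (hw x₀).add (hw' x₀)

theorem SmoothForm.smul (c : ℝ) {w : DForm E M k} (hw : SmoothForm I w) :
    SmoothForm I (c • w) := fun x₀ => by
  rw [inChart_smul]; exact contDiffOn_const.smul (hw x₀)

theorem SmoothForm.zero : SmoothForm I (0 : DForm E M k) := fun x₀ => by
  have : inChart I x₀ (0 : DForm E M k) = fun _ => 0 := by ext; simp [inChart]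
  rw [this]; exact contDiffOn_const

theorem SmoothForm.differentiableWithinAt {w : DForm E M k} (hw : SmoothForm I w) (x : M) :
    DifferentiableWithinAt ℝ (inChart I x w) (range I) (extChartAt I x x) :=
  ((hw x).differentiableOn (by simp) _ (mem_extChartAt_target x)).mono_of_mem_nhdsWithin
    (extChartAt_target_mem_nhdsWithin x)

theorem extD_add {w w' : DForm E M k} (hw : SmoothForm I w) (hw' : SmoothForm I w') :
    extD I (w + w') = extD I w + extD I w' := by
  funext x
  simp only [extD, inChart_add, Pi.add_apply]
  exact extDerivWithin_add (I.uniqueDiffOn _ (extChartAt_target_subset_range x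
    (mem_extChartAt_target x))) (hw.differentiableWithinAt I x) (hw'.differentiableWithinAt I x)

theorem extD_smul (c : ℝ) (w : DForm E M k) : extD I (c • w) = c • extD I w := by
  funext x
  simp only [extD, inChart_smul, Pi.smul_apply]
  exact extDerivWithin_smul c _ (I.uniqueDiffOn _ (extChartAt_target_subset_range x
    (mem_extChartAt_target x)))

theorem extD_zero : extD I (0 : DForm E M k) = 0 := by
  simpa using extD_smul I 0 (0 : DForm E M k)

variable (M) in
/-- The group of smooth closed `k`-forms. -/
def closedForms (k : ℕ) : AddSubgroup (DForm E M k) where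
  carrier := {w | SmoothForm I w ∧ extD I w = 0}
  add_mem' := fun ⟨hw, h⟩ ⟨hw', h'⟩ => ⟨hw.add I hw', by rw [extD_add I hw hw', h, h', add_zero]⟩
  zero_mem' := ⟨SmoothForm.zero I, extD_zero I⟩
  neg_mem' := fun {w} ⟨hw, h⟩ => by
    rw [← neg_one_smul ℝ w]
    exact ⟨hw.smul I _, by rw [extD_smul, h, smul_zero]⟩

variable (M) in
/-- The closed `(k + 1)`-forms that are differentials of smooth `k`-forms. -/
def exactForms (k : ℕ) : AddSubgroup (closedForms I M (k + 1)) where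
  carrier := {w | ∃ η : DForm E M k, SmoothForm I η ∧ extD I η = w}
  add_mem' := by
    rintro _ _ ⟨η, hη, h⟩ ⟨η', hη', h'⟩
    exact ⟨η + η', hη.add I hη', by rw [extD_add I hη hη', h, h']; rfl⟩
  zero_mem' := ⟨0, SmoothForm.zero I, extD_zero I⟩
  neg_mem' := by
    rintro w ⟨η, hη, h⟩
    exact ⟨(-1 : ℝ) • η, hη.smul I _, by
      rw [extD_smul, h]; exact neg_one_smul ℝ (w : DForm E M (k + 1))⟩

variable (M) in
/-- The de Rham cohomology group `H^{k+1}(M; ℝ)`: closed modulo exact `(k + 1)`-forms. -/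
abbrev DeRham (k : ℕ) : Type _ := closedForms I M (k + 1) ⧸ exactForms I M k

/-- The de Rham class of a closed form. -/
def deRhamClass (w : DForm E M (k + 1)) (hw : w ∈ closedForms I M (k + 1)) : DeRham I M k :=
  QuotientAddGroup.mk ⟨w, hw⟩

/-- `c` is the Godbillon-Vey class of the integrable one-form `τ`: there are smooth one-forms `α`
with `dτ = τ ∧ α`, and for each of them `α ∧ dα` is a closed form of class `c`. -/
def IsGodbillonVeyClass (τ : DForm E M 1) (c : DeRham I M 2) : Prop :=
  (∃ α : DForm E M 1, SmoothForm I α ∧ extD I τ = wedge τ α) ∧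
  ∀ α : DForm E M 1, SmoothForm I α → extD I τ = wedge τ α →
    ∃ h : wedge α (extD I α) ∈ closedForms I M 3, deRhamClass I (wedge α (extD I α)) h = c

end Forms

/-! ### Multivector fields depending on time -/

section Multivectors

variable {E : Type*} [NormedAddCommGroup E] [NormedSpace ℝ E]
  {H : Type*} [TopologicalSpace H] (I : ModelWithCorners ℝ E H)
  {M : Type*} [TopologicalSpace M] [ChartedSpace H M] {k m : ℕ}

variable (E M) in
/-- `k`-vector fields on `M`, that is, sections of `⋀^k TM`. -/
abbrev MultivectorField (k : ℕ) : Type _ := M → ⋀[ℝ]^k E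

/-- The contraction `ξ ⌟ w` of a `k`-vector field with a `(k + m)`-form. -/
def contractField (ξ : MultivectorField E M k) (w : DForm E M (k + m)) : DForm E M m :=
  fun x => contract (ξ x) (w x)

/-- A one-parameter family of `k`-vector fields is smooth if its components in each chart are
jointly smooth in the parameter and the point. -/
def SmoothMultivectorFamily [IsManifold I ∞ M] (J : Set ℝ) (ξ : ℝ → MultivectorField E M k) :
    Prop :=
  ∀ (x₀ : M) (l : Module.Dual ℝ (⋀[ℝ]^k E)),
    ContDiffOn ℝ ∞
      (fun q : ℝ × E => l (exteriorPower.map k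
        (tangentCoordChange I ((extChartAt I x₀).symm q.2) x₀ ((extChartAt I x₀).symm q.2) :
          E →ₗ[ℝ] E) (ξ q.1 ((extChartAt I x₀).symm q.2))))
      (J ×ˢ (extChartAt I x₀).target)

/-- The time derivative `∂ξ/∂t` of a family of `k`-vector fields, computed in a basis of the fixed
finite-dimensional space `⋀^k T_x M`. -/
def timeDerivMultivector [FiniteDimensional ℝ E] (ξ : ℝ → MultivectorField E M k) (t : ℝ) :
    MultivectorField E M k := fun x =>
  ∑ i, deriv (fun s => (Module.finBasis ℝ (⋀[ℝ]^k E)).repr (ξ s x) i) t •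
    Module.finBasis ℝ (⋀[ℝ]^k E) i

end Multivectors

/-! ### Riemannian geometry and ideal fluids -/

section Fluids

variable {E : Type*} [NormedAddCommGroup E] [NormedSpace ℝ E]
  {H : Type*} [TopologicalSpace H] {I : ModelWithCorners ℝ E H}
  {M : Type*} [TopologicalSpace M] [ChartedSpace H M] [IsManifold I ∞ M]

variable (I M) in
/-- Smooth Riemannian metrics on `M`. -/
abbrev Metric := ContMDiffRiemannianMetric I ∞ E (fun x : M => TangentSpace I x)

/-- The one-form `X^♭ = ι_X g`. -/
def flat (g : Metric I M) (X : (x : M) → TangentSpace I x) : DForm E M 1 :=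
  fun x => ofCovector (g.inner x (X x))

theorem flat_bijective [FiniteDimensional ℝ E] (g : Metric I M) (x : M) :
    Function.Bijective (g.inner x : TangentSpace I x →ₗ[ℝ] (TangentSpace I x →L[ℝ] ℝ)) := by
  have : FiniteDimensional ℝ (TangentSpace I x) := inferInstanceAs (FiniteDimensional ℝ E)
  have : T2Space (TangentSpace I x) := inferInstanceAs (T2Space E)
  have hinj : Function.Injective
      (g.inner x : TangentSpace I x →ₗ[ℝ] (TangentSpace I x →L[ℝ] ℝ)) := by
    rw [injective_iff_map_eq_zero]
    intro u hu
    by_contra hne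
    have h0 := g.pos x u hne
    have h1 : g.inner x u = 0 := hu
    rw [h1] at h0
    simp at h0
  have e : (TangentSpace I x →L[ℝ] ℝ) ≃ₗ[ℝ] Module.Dual ℝ (TangentSpace I x) :=
    LinearMap.toContinuousLinearMap.symm
  have hd : Module.finrank ℝ (TangentSpace I x)
      = Module.finrank ℝ (TangentSpace I x →L[ℝ] ℝ) := by
    rw [e.finrank_eq, Subspace.dual_finrank_eq]
  have : FiniteDimensional ℝ (TangentSpace I x →L[ℝ] ℝ) := e.symm.finiteDimensional
  exact ⟨hinj, (LinearMap.injective_iff_surjective_of_finrank_eq_finrank hd).1 hinj⟩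

/-- The linear isomorphism `T_x M → T_x^* M` given by the metric. -/
def flatEquiv [FiniteDimensional ℝ E] (g : Metric I M) (x : M) :
    TangentSpace I x ≃ₗ[ℝ] (TangentSpace I x →L[ℝ] ℝ) :=
  LinearEquiv.ofBijective
    (g.inner x : TangentSpace I x →ₗ[ℝ] (TangentSpace I x →L[ℝ] ℝ)) (flat_bijective g x)

/-- The vector `a^♯ = ι_a g⁻¹` dual to a covector. -/
def sharp [FiniteDimensional ℝ E] (g : Metric I M) (x : M) (a : TangentSpace I x →L[ℝ] ℝ) :
    TangentSpace I x := (flatEquiv g x).symm a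

/-- The cometric `g⁻¹` on covectors. -/
def cometric [FiniteDimensional ℝ E] (g : Metric I M) (x : M) (a b : TangentSpace I x →L[ℝ] ℝ) :
    ℝ := a (sharp g x b)

/-- `X` is a vector field that is differentiable at `x`. -/
def DiffVectorAt (X : (x : M) → TangentSpace I x) (x : M) : Prop :=
  MDifferentiableAt I I.tangent (fun y => (⟨y, X y⟩ : TangentBundle I M)) x

/-- `conn` is the Riemannian (Levi-Civita) connection of `g`: it preserves the metric and is free
of torsion. Here `conn Y x u` stands for `(∇_u Y)(x)`. -/
def IsLeviCivita (g : Metric I M)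
    (conn : CovariantDerivative I E (TangentSpace I : M → Type _)) : Prop :=
  (∀ (Y Z : (x : M) → TangentSpace I x) (x : M) (u : TangentSpace I x),
    DiffVectorAt Y x → DiffVectorAt Z x →
    mvfderiv I (fun y => g.inner y (Y y) (Z y)) x u
      = g.inner x (conn Y x u) (Z x) + g.inner x (Y x) (conn Z x u)) ∧
  (∀ (X Y : (x : M) → TangentSpace I x) (x : M), DiffVectorAt X x → DiffVectorAt Y x →
    conn Y x (X x) - conn X x (Y x) = VectorField.mlieBracket I X Y x)

variable (I) in
/-- The tangent vector `u ∈ T_x M` is parallel to the boundary of `M`: both `u` and `-u` belong to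
the cone of tangent vectors pointing into `M`. This is no condition at interior points. -/
def ParallelToBoundaryAt (x : M) (u : E) : Prop :=
  u ∈ posTangentConeAt (range I) (extChartAt I x x) ∧
  -u ∈ posTangentConeAt (range I) (extChartAt I x x)

variable (I M) in
/-- An ideal incompressible fluid flowing in a manifold `M` of dimension `k + 2`, during the set of
times `J`. The orientation of `M` is the one given by the volume form `μ`. -/
structure IdealFluid [FiniteDimensional ℝ E] (k : ℕ) (J : Set ℝ) where
  /-- the Riemannian metric -/
  g : Metric I M
  /-- the Riemannian connection -/
  conn : CovariantDerivative I E (TangentSpace I : M → Type _)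
  leviCivita : IsLeviCivita g conn
  /-- the fluid density, a volume form -/
  μ : DForm E M (k + 2)
  μ_smooth : SmoothForm I μ
  μ_ne_zero : ∀ x, μ x ≠ 0
  /-- the fluid velocity -/
  v : ℝ → (x : M) → TangentSpace I x
  v_smooth : ContMDiffOn (𝓘(ℝ, ℝ).prod I) I.tangent ∞
    (fun q : ℝ × M => (⟨q.2, v q.1 q.2⟩ : TangentBundle I M)) (J ×ˢ univ)
  /-- no flux through the boundary -/
  v_parallel : ∀ t ∈ J, ∀ x : M, ParallelToBoundaryAt (E := E) I x (v t x)
  /-- the pressure -/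
  p : ℝ → M → ℝ
  p_smooth : ContMDiffOn (𝓘(ℝ, ℝ).prod I) 𝓘(ℝ, ℝ) ∞ (fun q : ℝ × M => p q.1 q.2) (J ×ˢ univ)
  /-- the Euler equation `∂v/∂t + ∇_v v = -(dp)^♯` -/
  euler : ∀ t ∈ J, ∀ x : M,
    deriv (fun s => v s x) t + conn (v t) x (v t x) = - sharp g x (mvfderiv I (p t) x)
  /-- the incompressibility `div_μ(v) = 0` -/
  divergence_free : ∀ t ∈ J, extD I (interiorProd I (v t) μ) = 0

variable (I M) in
/-- An (ideal, incompressible and integrable) Aristotelian fluid: an ideal incompressible fluid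
with a one-parameter family `(τ, v, h, γ)` of Aristotelian structures. The tensors `h` and `γ` are
determined by `g`, `v` and `τ` and inherit their smoothness. -/
structure AristotelianFluid [FiniteDimensional ℝ E] (k : ℕ) (J : Set ℝ) extends
    IdealFluid I M k J where
  /-- the clock form -/
  τ : ℝ → DForm E M 1
  τ_smooth : SmoothFormFamily I J τ
  /-- the spatial metric -/
  h : ℝ → (x : M) → TangentSpace I x →L[ℝ] TangentSpace I x →L[ℝ] ℝ
  h_symm : ∀ t ∈ J, ∀ x u w, h t x u w = h t x w u
  /-- the spatial cometric -/
  γ : ℝ → (x : M) → (TangentSpace I x →L[ℝ] ℝ) →L[ℝ] (TangentSpace I x →L[ℝ] ℝ) →L[ℝ] ℝ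
  γ_symm : ∀ t ∈ J, ∀ x a b, γ t x a b = γ t x b a
  τ_v : ∀ t ∈ J, ∀ x, covectorAt I (τ t) x (v t x) = 1
  h_v : ∀ t ∈ J, ∀ x, h t x (v t x) = 0
  γ_τ : ∀ t ∈ J, ∀ x, γ t x (covectorAt I (τ t) x) = 0
  /-- `ker τ` and `Span v` are orthogonal -/
  orthogonal : ∀ t ∈ J, ∀ x (u : TangentSpace I x), covectorAt I (τ t) x u = 0 →
    g.inner x u (v t x) = 0
  h_eq : ∀ t ∈ J, ∀ x (u w : TangentSpace I x), covectorAt I (τ t) x u = 0 →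
    covectorAt I (τ t) x w = 0 → h t x u w = g.inner x u w
  γ_eq : ∀ t ∈ J, ∀ x (a b : TangentSpace I x →L[ℝ] ℝ), a (v t x) = 0 → b (v t x) = 0 →
    γ t x a b = cometric g x a b
  /-- the Frobenius integrability condition -/
  integrable : ∀ t ∈ J, ∃ α : DForm E M 1, SmoothForm I α ∧ extD I (τ t) = wedge (τ t) α

variable [FiniteDimensional ℝ E] {k : ℕ} {J : Set ℝ}

/-- The (squared) speed `s_v = g(v, v)`. -/
def IdealFluid.speed (F : IdealFluid I M k J) (t : ℝ) : M → ℝ :=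
  fun x => F.g.inner x (F.v t x) (F.v t x)

/-- The covector potential `v^♭`. -/
def IdealFluid.vflat (F : IdealFluid I M k J) (t : ℝ) : DForm E M 1 := flat F.g (F.v t)

/-- `ξ` is the vorticity of the fluid: the family of `(n - 2)`-vector fields with
`ξ ⌟ μ = d v^♭`. -/
def IdealFluid.IsVorticity (F : IdealFluid I M k J) (ξ : ℝ → MultivectorField E M k) : Prop :=
  SmoothMultivectorFamily I J ξ ∧ ∀ t ∈ J, contractField (ξ t) F.μ = extD I (F.vflat t)

/-- The one-form `α = £_v τ`, which satisfies `dτ = τ ∧ α` and `ι_v α = 0`. -/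
def AristotelianFluid.alpha (F : AristotelianFluid I M k J) (t : ℝ) : DForm E M 1 :=
  lieForm I (F.v t) (F.τ t)

/-- The one-form `α_v = £_v τ - d log s_v`. -/
def AristotelianFluid.alphaV (F : AristotelianFluid I M k J) (t : ℝ) : DForm E M 1 :=
  F.alpha t - dFun I (fun x => Real.log (F.speed t x))

end Fluids

end AristotelianHydro

end

open AristotelianHydro

namespace AristotelianHydro

/-! ### Algebra of `wedgePt` and contractions -/

section PointwiseAlgebra

open ContinuousAlternatingMap

variable {V W : Type*} [NormedAddCommGroup V] [NormedSpace ℝ V]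
  [NormedAddCommGroup W] [NormedSpace ℝ W] {k m : ℕ}

theorem eq_zero_of_eq_neg_self {A : Type*} [AddCommGroup A] [Module ℝ A] {a : A} (h : a = -a) :
    a = 0 := by
  have h2 : (2 : ℝ) • a = 0 := by
    rw [two_smul]
    exact eq_neg_iff_add_eq_zero.1 h
  simpa using h2

theorem toCovector_apply (a : V [⋀^Fin 1]→L[ℝ] ℝ) (u : V) : toCovector a u = a (fun _ => u) := rfl

theorem toCovector_injective :
    Function.Injective (toCovector : (V [⋀^Fin 1]→L[ℝ] ℝ) → V →L[ℝ] ℝ) :=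
  (ContinuousAlternatingMap.ofSubsingleton ℝ V ℝ 0).symm.injective

@[simp]
theorem toCovector_smul (c : ℝ) (a : V [⋀^Fin 1]→L[ℝ] ℝ) :
    toCovector (c • a) = c • toCovector a := rfl

@[simp]
theorem toCovector_sub (a b : V [⋀^Fin 1]→L[ℝ] ℝ) :
    toCovector (a - b) = toCovector a - toCovector b := rfl

/-- `toCovector` as a continuous linear map. -/
noncomputable def toCovectorL : (V [⋀^Fin 1]→L[ℝ] ℝ) →L[ℝ] V →L[ℝ] ℝ :=
  ((ofSubsingletonLIE (𝕜 := ℝ) (E := V) (F := ℝ) (0 : Fin 1)).symm.toContinuousLinearEquiv :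
    (V [⋀^Fin 1]→L[ℝ] ℝ) →L[ℝ] V →L[ℝ] ℝ)

theorem toCovectorL_apply (a : V [⋀^Fin 1]→L[ℝ] ℝ) : toCovectorL a = toCovector a := rfl

/-- `ofCovector` as a continuous linear map. -/
noncomputable def ofCovectorL : (V →L[ℝ] ℝ) →L[ℝ] V [⋀^Fin 1]→L[ℝ] ℝ :=
  ((ofSubsingletonLIE (𝕜 := ℝ) (E := V) (F := ℝ) (0 : Fin 1)).toContinuousLinearEquiv :
    (V →L[ℝ] ℝ) →L[ℝ] V [⋀^Fin 1]→L[ℝ] ℝ)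

/-- The exterior product with a covector as a continuous bilinear map. -/
noncomputable def wedgeL (k : ℕ) : (V [⋀^Fin 1]→L[ℝ] ℝ) →L[ℝ] (V [⋀^Fin k]→L[ℝ] ℝ) →L[ℝ]
    V [⋀^Fin (k + 1)]→L[ℝ] ℝ :=
  (ContinuousLinearMap.compL ℝ _ _ _ (alternatizeUncurryFinCLM ℝ V ℝ)) ∘L
    (ContinuousLinearMap.smulRightL ℝ V (V [⋀^Fin k]→L[ℝ] ℝ)) ∘L toCovectorL

theorem wedgeL_apply (a : V [⋀^Fin 1]→L[ℝ] ℝ) (w : V [⋀^Fin k]→L[ℝ] ℝ) :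
    wedgeL k a w = wedgePt a w := rfl

theorem wedgePt_apply (a : V [⋀^Fin 1]→L[ℝ] ℝ) (w : V [⋀^Fin k]→L[ℝ] ℝ) (v : Fin (k + 1) → V) :
    wedgePt a w v
      = ∑ i : Fin (k + 1), (-1) ^ (i : ℕ) • (toCovector a (v i) * w (i.removeNth v)) := by
  simp [wedgePt, alternatizeUncurryFin_apply]

theorem wedgePt_add_left (a b : V [⋀^Fin 1]→L[ℝ] ℝ) (w : V [⋀^Fin k]→L[ℝ] ℝ) :
    wedgePt (a + b) w = wedgePt a w + wedgePt b w := by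
  simp [← wedgeL_apply]

theorem wedgePt_sub_left (a b : V [⋀^Fin 1]→L[ℝ] ℝ) (w : V [⋀^Fin k]→L[ℝ] ℝ) :
    wedgePt (a - b) w = wedgePt a w - wedgePt b w := by
  simp [← wedgeL_apply]

theorem wedgePt_smul_left (c : ℝ) (a : V [⋀^Fin 1]→L[ℝ] ℝ) (w : V [⋀^Fin k]→L[ℝ] ℝ) :
    wedgePt (c • a) w = c • wedgePt a w := by
  simp [← wedgeL_apply]

theorem wedgePt_add_right (a : V [⋀^Fin 1]→L[ℝ] ℝ) (w w' : V [⋀^Fin k]→L[ℝ] ℝ) :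
    wedgePt a (w + w') = wedgePt a w + wedgePt a w' := by
  simp [← wedgeL_apply]

theorem wedgePt_sub_right (a : V [⋀^Fin 1]→L[ℝ] ℝ) (w w' : V [⋀^Fin k]→L[ℝ] ℝ) :
    wedgePt a (w - w') = wedgePt a w - wedgePt a w' := by
  simp [← wedgeL_apply]

theorem wedgePt_neg_right (a : V [⋀^Fin 1]→L[ℝ] ℝ) (w : V [⋀^Fin k]→L[ℝ] ℝ) :
    wedgePt a (-w) = - wedgePt a w := by
  simp [← wedgeL_apply]

theorem wedgePt_smul_right (c : ℝ) (a : V [⋀^Fin 1]→L[ℝ] ℝ) (w : V [⋀^Fin k]→L[ℝ] ℝ) :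
    wedgePt a (c • w) = c • wedgePt a w := by
  simp [← wedgeL_apply]

theorem wedgePt_zero_right (a : V [⋀^Fin 1]→L[ℝ] ℝ) :
    wedgePt a (0 : V [⋀^Fin k]→L[ℝ] ℝ) = 0 := by
  simp [← wedgeL_apply]

theorem alternatizeUncurryFin_wedgePt_of_symm (B : V →L[ℝ] V [⋀^Fin 1]→L[ℝ] ℝ)
    (hB : ∀ u w, toCovector (B u) w = toCovector (B w) u) (w : V [⋀^Fin k]→L[ℝ] ℝ) :
    alternatizeUncurryFin ((wedgeL k).flip w ∘L B) = 0 := by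
  rw [← alternatizeUncurryFin_alternatizeUncurryFinCLM_comp_of_symmetric
    (f := ((ContinuousLinearMap.smulRightL ℝ V (V [⋀^Fin k]→L[ℝ] ℝ)).flip w) ∘L toCovectorL ∘L B)]
  · rfl
  · intro x y
    simp [toCovectorL_apply, hB x y]

theorem alternatizeUncurryFin_toCovector_apply (B : V →L[ℝ] V [⋀^Fin 1]→L[ℝ] ℝ) (v : Fin 2 → V) :
    alternatizeUncurryFin B v = toCovector (B (v 0)) (v 1) - toCovector (B (v 1)) (v 0) := by
  rw [alternatizeUncurryFin_apply, Fin.sum_univ_two]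
  simp only [toCovector_apply]
  have h0 : (0 : Fin 2).removeNth v = fun _ => v 1 := by
    ext i; fin_cases i; simp [Fin.removeNth]
  have h1 : (1 : Fin 2).removeNth v = fun _ => v 0 := by
    ext i; fin_cases i; simp [Fin.removeNth]
  rw [h0, h1]
  simp [sub_eq_add_neg]

/-- If the two-form `∑ eᵢ ∧ B(eᵢ)` is `a ∧ b`, then `∑ eᵢ ∧ B(eᵢ) ∧ w` is `a ∧ b ∧ w`. -/
theorem alternatizeUncurryFin_wedgePt_left {B : V →L[ℝ] V [⋀^Fin 1]→L[ℝ] ℝ}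
    {a b : V [⋀^Fin 1]→L[ℝ] ℝ} (hB : alternatizeUncurryFin B = wedgePt a b)
    (w : V [⋀^Fin k]→L[ℝ] ℝ) :
    alternatizeUncurryFin ((wedgeL k).flip w ∘L B) = wedgePt a (wedgePt b w) := by
  set C : V →L[ℝ] V [⋀^Fin 1]→L[ℝ] ℝ := (toCovector a).smulRight b with hC
  have h : ∀ u w, toCovector ((B - C) u) w = toCovector ((B - C) w) u := by
    intro u w
    have h := congrArg (fun f => f ![u, w]) hB
    rw [wedgePt, ← hC] at h
    simp only [alternatizeUncurryFin_toCovector_apply] at h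
    simp only [_root_.sub_apply, toCovector_sub]
    simp only [Matrix.cons_val_zero, Matrix.cons_val_one] at h
    linarith
  have h0 := alternatizeUncurryFin_wedgePt_of_symm (B - C) h w
  rw [ContinuousLinearMap.comp_sub, ← alternatizeUncurryFinCLM_apply, map_sub, sub_eq_zero] at h0
  rw [← alternatizeUncurryFinCLM_apply, h0, wedgePt, ← alternatizeUncurryFinCLM_apply]
  congr 1
  ext u : 1
  simp [hC, wedgeL_apply]

/-- `∑ eᵢ ∧ a ∧ W(eᵢ) = - a ∧ ∑ eᵢ ∧ W(eᵢ)`. -/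
theorem alternatizeUncurryFin_wedgePt_right (a : V [⋀^Fin 1]→L[ℝ] ℝ)
    (W : V →L[ℝ] V [⋀^Fin k]→L[ℝ] ℝ) :
    alternatizeUncurryFin (wedgeL k a ∘L W) = - wedgePt a (alternatizeUncurryFin W) := by
  rw [eq_neg_iff_add_eq_zero, wedgePt, ← alternatizeUncurryFin_add]
  rw [← alternatizeUncurryFin_alternatizeUncurryFinCLM_comp_of_symmetric
    (f := (ContinuousLinearMap.smulRightL ℝ V (V [⋀^Fin k]→L[ℝ] ℝ) (toCovector a)) ∘L W +
      (toCovector a).smulRight W)]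
  · congr 1
    ext u : 1
    simp only [_root_.add_apply, ContinuousLinearMap.comp_apply,
      ContinuousLinearMap.smulRight_apply, map_add, map_smul, wedgeL_apply,
      alternatizeUncurryFinCLM_apply]
    rfl
  · intro x y
    simp [add_comm]

theorem wedgePt_swap (a b : V [⋀^Fin 1]→L[ℝ] ℝ) (w : V [⋀^Fin k]→L[ℝ] ℝ) :
    wedgePt a (wedgePt b w) = - wedgePt b (wedgePt a w) := by
  conv_rhs => rw [wedgePt.eq_1 a, ← alternatizeUncurryFin_wedgePt_right]
  rw [wedgePt.eq_1 a]
  congr 1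
  ext u : 1
  simp [wedgeL_apply]

theorem wedgePt_wedgePt_self (a : V [⋀^Fin 1]→L[ℝ] ℝ) (w : V [⋀^Fin k]→L[ℝ] ℝ) :
    wedgePt a (wedgePt a w) = 0 :=
  eq_zero_of_eq_neg_self (wedgePt_swap a a w)

theorem wedgePt_comm (a b : V [⋀^Fin 1]→L[ℝ] ℝ) : wedgePt a b = - wedgePt b a := by
  ext v
  simp only [wedgePt, ContinuousAlternatingMap.neg_apply, alternatizeUncurryFin_toCovector_apply,
    ContinuousLinearMap.smulRight_apply, toCovector_smul, _root_.smul_apply, smul_eq_mul]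
  ring

theorem wedgePt_self (a : V [⋀^Fin 1]→L[ℝ] ℝ) : wedgePt a a = 0 :=
  eq_zero_of_eq_neg_self (wedgePt_comm a a)

/-- Cyclic symmetry of the exterior product of three covectors. -/
theorem wedgePt_cycle (a b c : V [⋀^Fin 1]→L[ℝ] ℝ) :
    wedgePt a (wedgePt b c) = wedgePt b (wedgePt c a) := by
  rw [wedgePt_swap a b c, wedgePt_comm c a, wedgePt_neg_right]

theorem curryLeft_wedgePt (a : V [⋀^Fin 1]→L[ℝ] ℝ) (w : V [⋀^Fin (k + 1)]→L[ℝ] ℝ) (u : V) :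
    (wedgePt a w).curryLeft u = toCovector a u • w - wedgePt a (w.curryLeft u) := by
  ext v
  rw [curryLeft_apply_apply, wedgePt_apply, Fin.sum_univ_succ]
  simp only [ContinuousAlternatingMap.sub_apply, ContinuousAlternatingMap.smul_apply, wedgePt_apply,
    smul_eq_mul]
  have h0 : (0 : Fin (k + 2)).removeNth (Matrix.vecCons u v) = v := by
    ext i; simp [Fin.removeNth]
  rw [h0, sub_eq_add_neg, ← Finset.sum_neg_distrib]
  simp only [Fin.val_zero, pow_zero, Matrix.cons_val_zero, one_smul]
  congr 1
  refine Finset.sum_congr rfl fun i _ => ?_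
  have h1 : i.succ.removeNth (Matrix.vecCons u v) = Matrix.vecCons u (i.removeNth v) := by
    ext j
    refine Fin.cases ?_ (fun j => ?_) j <;> simp [Fin.removeNth]
  rw [h1]
  simp [pow_succ]

theorem wedgePt_constOfIsEmpty (a : V [⋀^Fin 1]→L[ℝ] ℝ) (w : V [⋀^Fin 0]→L[ℝ] ℝ) :
    wedgePt a w = w 0 • a := by
  ext v
  rw [wedgePt_apply]
  simp only [Fin.sum_univ_succ, Fin.val_zero, pow_zero, Finset.univ_eq_empty, Finset.sum_empty,
    ContinuousAlternatingMap.smul_apply, smul_eq_mul, add_zero, one_smul]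
  rw [mul_comm, toCovector_apply, Subsingleton.elim (Fin.removeNth 0 v) 0]
  congr 2
  funext i
  rw [Subsingleton.elim i 0]

theorem curryLeft_one_apply (a : V [⋀^Fin 1]→L[ℝ] ℝ) (u : V) (z : Fin 0 → V) :
    a.curryLeft u z = toCovector a u := by
  rw [curryLeft_apply_apply, toCovector_apply]
  congr 1
  ext i; fin_cases i; rfl

theorem curryLeft_wedgePt_one (a b : V [⋀^Fin 1]→L[ℝ] ℝ) (u : V) :
    (wedgePt a b).curryLeft u = toCovector a u • b - toCovector b u • a := by
  rw [curryLeft_wedgePt, wedgePt_constOfIsEmpty, curryLeft_one_apply]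

theorem wedgePt_compContinuousLinearMap (a : W [⋀^Fin 1]→L[ℝ] ℝ) (w : W [⋀^Fin k]→L[ℝ] ℝ)
    (L : V →L[ℝ] W) :
    (wedgePt a w).compContinuousLinearMap L
      = wedgePt (a.compContinuousLinearMap L) (w.compContinuousLinearMap L) := by
  ext v
  simp only [compContinuousLinearMap_apply, wedgePt_apply]
  rfl

theorem curryLeft_compContinuousLinearMap (w : W [⋀^Fin (k + 1)]→L[ℝ] ℝ) (L : V →L[ℝ] W) (u : V) :
    (w.compContinuousLinearMap L).curryLeft u
      = (w.curryLeft (L u)).compContinuousLinearMap L := by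
  ext v
  simp only [compContinuousLinearMap_apply, curryLeft_apply_apply]
  congr 1
  ext i
  refine Fin.cases ?_ (fun j => ?_) i <;> simp

theorem contract_sum {ι : Type*} (s : Finset ι) (c : ι → ℝ) (e : ι → ⋀[ℝ]^k V)
    (w : V [⋀^Fin (k + m)]→L[ℝ] ℝ) :
    contract (∑ i ∈ s, c i • e i) w = ∑ i ∈ s, c i • contract (e i) w := by
  simp [contract]

theorem contract_zero (w : V [⋀^Fin (k + m)]→L[ℝ] ℝ) : contract (0 : ⋀[ℝ]^k V) w = 0 := by
  simp [contract]

end PointwiseAlgebra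

/-! ### The Leibniz rule for the exterior derivative -/

section Leibniz

open ContinuousAlternatingMap

variable {E : Type*} [NormedAddCommGroup E] [NormedSpace ℝ E] {k : ℕ} {s : Set E} {x : E}

theorem extDerivWithin_fun_smul_form {f : E → ℝ} {w : E → E [⋀^Fin k]→L[ℝ] ℝ}
    (hf : DifferentiableWithinAt ℝ f s x) (hw : DifferentiableWithinAt ℝ w s x)
    (hs : UniqueDiffWithinAt ℝ s x) :
    extDerivWithin (fun y => f y • w y) s x
      = wedgePt (ofCovector (fderivWithin ℝ f s x)) (w x) + f x • extDerivWithin w s x := by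
  rw [extDerivWithin, fderivWithin_fun_smul hs hf hw, alternatizeUncurryFin_add,
    alternatizeUncurryFin_smul]
  exact add_comm _ _

theorem extDerivWithin_wedgePt {β : E → E [⋀^Fin 1]→L[ℝ] ℝ} {w : E → E [⋀^Fin k]→L[ℝ] ℝ}
    (hβ : DifferentiableWithinAt ℝ β s x) (hw : DifferentiableWithinAt ℝ w s x)
    (hs : UniqueDiffWithinAt ℝ s x) {a b : E [⋀^Fin 1]→L[ℝ] ℝ}
    (hab : extDerivWithin β s x = wedgePt a b) :
    extDerivWithin (fun y => wedgePt (β y) (w y)) s x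
      = wedgePt a (wedgePt b (w x)) - wedgePt (β x) (extDerivWithin w s x) := by
  simp only [← wedgeL_apply]
  rw [extDerivWithin, ContinuousLinearMap.fderivWithin_of_bilinear _ hβ hw hs,
    alternatizeUncurryFin_add, sub_eq_neg_add]
  simp only [wedgeL_apply]
  congr 1
  · exact alternatizeUncurryFin_wedgePt_right (β x) (fderivWithin ℝ w s x)
  · exact alternatizeUncurryFin_wedgePt_left hab (w x)

end Leibniz

/-! ### Forms in charts -/

theorem minSmoothness_two_le_infty : minSmoothness ℝ 2 ≤ (∞ : WithTop ℕ∞) := by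
  rw [minSmoothness_of_isRCLikeNormedField]
  exact ENat.LEInfty.out

section Charts

variable {E : Type*} [NormedAddCommGroup E] [NormedSpace ℝ E]
  {H : Type*} [TopologicalSpace H] (I : ModelWithCorners ℝ E H)
  {M : Type*} [TopologicalSpace M] [ChartedSpace H M] [IsManifold I ∞ M] {k : ℕ}

/-- The coordinate expression of a vector field in the preferred chart at `x₀`. -/
noncomputable def vectorInChart (x₀ : M) (X : (x : M) → TangentSpace I x) : E → E := fun y =>
  tangentCoordChange I ((extChartAt I x₀).symm y) x₀ ((extChartAt I x₀).symm y)
    (X ((extChartAt I x₀).symm y))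

/-- A function seen as a form of degree zero. -/
noncomputable def zeroForm (f : M → ℝ) : DForm E M 0 := fun x =>
  ContinuousAlternatingMap.constOfIsEmpty ℝ E (Fin 0) (f x)

variable {I}

theorem tangentCoordChange_symm_apply {x₀ z : M} (hz : z ∈ (extChartAt I x₀).source) (u : E) :
    tangentCoordChange I x₀ z z (tangentCoordChange I z x₀ z u) = u := by
  rw [tangentCoordChange_comp ⟨⟨mem_extChartAt_source z, hz⟩, mem_extChartAt_source z⟩,
    tangentCoordChange_self (mem_extChartAt_source z)]

theorem tangentCoordChange_self_self (x : M) :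
    tangentCoordChange I x x x = ContinuousLinearMap.id ℝ E := by
  ext u
  exact tangentCoordChange_self (mem_extChartAt_source x)

theorem inChart_self (x : M) (w : DForm E M k) : inChart I x w (extChartAt I x x) = w x := by
  simp only [inChart]
  rw [extChartAt_to_inv, tangentCoordChange_self_self]
  rfl

theorem vectorInChart_self (x : M) (X : (x : M) → TangentSpace I x) :
    vectorInChart I x X (extChartAt I x x) = X x := by
  simp only [vectorInChart]
  rw [extChartAt_to_inv, tangentCoordChange_self_self]
  rfl

omit [IsManifold I ∞ M] in
theorem uniqueDiffWithinAt_range {x₀ : M} {y : E} (hy : y ∈ (extChartAt I x₀).target) :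
    UniqueDiffWithinAt ℝ (range I) y :=
  I.uniqueDiffOn _ (extChartAt_target_subset_range x₀ hy)

theorem inChart_wedge (x₀ : M) (α : DForm E M 1) (w : DForm E M k) :
    inChart I x₀ (wedge α w) = fun y => wedgePt (inChart I x₀ α y) (inChart I x₀ w y) := by
  funext y
  exact wedgePt_compContinuousLinearMap _ _ _

theorem inChart_fun_smul (x₀ : M) (f : M → ℝ) (w : DForm E M k) :
    inChart I x₀ (fun x => f x • w x)
      = fun y => f ((extChartAt I x₀).symm y) • inChart I x₀ w y := rfl

theorem inChart_zeroForm (x₀ : M) (f : M → ℝ) :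
    inChart I x₀ (zeroForm f) = fun y =>
      ContinuousAlternatingMap.constOfIsEmpty ℝ E (Fin 0) (f ((extChartAt I x₀).symm y)) := rfl

theorem inChart_interiorProd (x₀ : M) (X : (x : M) → TangentSpace I x) (w : DForm E M (k + 1))
    {y : E} (hy : y ∈ (extChartAt I x₀).target) :
    inChart I x₀ (interiorProd I X w) y = (inChart I x₀ w y).curryLeft (vectorInChart I x₀ X y) := by
  simp only [inChart, vectorInChart, interiorProd]
  rw [curryLeft_compContinuousLinearMap]
  congr 2
  exact (tangentCoordChange_symm_apply ((extChartAt I x₀).map_target hy) _).symm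

theorem inChart_extD (x₀ : M) {w : DForm E M k} (hw : SmoothForm I w) {y : E}
    (hy : y ∈ (extChartAt I x₀).target) :
    inChart I x₀ (extD I w) y = extDerivWithin (inChart I x₀ w) (range I) y := by
  set z := (extChartAt I x₀).symm y with hz
  have hzs : z ∈ (extChartAt I x₀).source := (extChartAt I x₀).map_target hy
  have hzy : extChartAt I x₀ z = y := (extChartAt I x₀).right_inv hy
  set φ := extChartAt I z ∘ (extChartAt I x₀).symm with hφ
  have hφy : φ y = extChartAt I z z := by simp [hφ, hz]
  have hN : ∀ᶠ u in 𝓝[range I] y, u ∈ (extChartAt I x₀).target ∧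
      (extChartAt I x₀).symm u ∈ (extChartAt I z).source := by
    rw [← nhdsWithin_extChartAt_target_eq_of_mem hy]
    exact Filter.Eventually.and self_mem_nhdsWithin ((continuousOn_extChartAt_symm x₀ y hy).preimage_mem_nhdsWithin
      ((isOpen_extChartAt_source z).mem_nhds (mem_extChartAt_source z)))
  have heq : inChart I x₀ w =ᶠ[𝓝[range I] y] fun u =>
      (inChart I z w (φ u)).compContinuousLinearMap (fderivWithin ℝ φ (range I) u) := by
    filter_upwards [hN] with u hu
    have hu1 : (extChartAt I z).symm (φ u) = (extChartAt I x₀).symm u :=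
      (extChartAt I z).left_inv hu.2
    have hus : (extChartAt I x₀).symm u ∈ (extChartAt I x₀).source :=
      (extChartAt I x₀).map_target hu.1
    have hd : fderivWithin ℝ φ (range I) u
        = tangentCoordChange I x₀ z ((extChartAt I x₀).symm u) := by
      rw [tangentCoordChange_def, (extChartAt I x₀).right_inv hu.1]
    rw [hd]
    simp only [inChart, hu1]
    ext v
    simp only [ContinuousAlternatingMap.compContinuousLinearMap_apply]
    congr 1
    ext i
    exact (tangentCoordChange_comp ⟨⟨hus, hu.2⟩, mem_extChartAt_source _⟩).symm
  have hyr : y ∈ range I := extChartAt_target_subset_range x₀ hy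
  have hφs : ContDiffWithinAt ℝ ∞ φ (range I) y :=
    contDiffWithinAt_ext_coord_change z x₀ (by
      rw [PartialEquiv.trans_source]
      exact ⟨hy, mem_extChartAt_source z⟩)
  have hmaps : MapsTo φ (range I) (range I) := fun u _ => by
    simp only [hφ, Function.comp_apply, extChartAt_coe]
    exact mem_range_self _
  rw [heq.extDerivWithin_eq_of_mem hyr,
    extDerivWithin_pullback (by rw [hφy]; exact hw.differentiableWithinAt I z) hφs minSmoothness_two_le_infty
      I.uniqueDiffOn (I.range_subset_closure_interior hyr) hyr hmaps, hφy]
  simp only [inChart, extD, ← hz]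
  rw [tangentCoordChange_def, hzy]

theorem SmoothForm.contDiffWithinAt {w : DForm E M k} (hw : SmoothForm I w) (x₀ : M) {y : E}
    (hy : y ∈ (extChartAt I x₀).target) : ContDiffWithinAt ℝ ∞ (inChart I x₀ w) (range I) y :=
  ((hw x₀) y hy).mono_of_mem_nhdsWithin (extChartAt_target_mem_nhdsWithin_of_mem hy)

theorem SmoothForm.extD {w : DForm E M k} (hw : SmoothForm I w) : SmoothForm I (extD I w) := by
  intro x₀
  have h : ContDiffOn ℝ ∞ (fun y => ContinuousAlternatingMap.alternatizeUncurryFinCLM ℝ E ℝ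
      (fderivWithin ℝ (inChart I x₀ w) (extChartAt I x₀).target y)) (extChartAt I x₀).target :=
    (ContinuousAlternatingMap.alternatizeUncurryFinCLM ℝ E ℝ).contDiff.comp_contDiffOn
      ((hw x₀).fderivWithin (uniqueDiffOn_extChartAt_target x₀) (by simp))
  refine h.congr fun y hy => ?_
  rw [inChart_extD x₀ hw hy, extDerivWithin, fderivWithin_of_mem_nhdsWithin
    (extChartAt_target_mem_nhdsWithin_of_mem hy)
    (uniqueDiffWithinAt_range hy) ((hw x₀).differentiableOn (by simp) y hy)]
  · rfl

theorem extD_extD {w : DForm E M k} (hw : SmoothForm I w) : extD I (extD I w) = 0 := by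
  funext x
  have hy := mem_extChartAt_target (I := I) x
  have hyr : extChartAt I x x ∈ range I := extChartAt_target_subset_range x hy
  have heq : inChart I x (AristotelianHydro.extD I w)
      =ᶠ[𝓝[range I] (extChartAt I x x)] extDerivWithin (inChart I x w) (range I) := by
    filter_upwards [extChartAt_target_mem_nhdsWithin x] with y hy
    exact inChart_extD x hw hy
  rw [extD, heq.extDerivWithin_eq_of_mem hyr]
  exact extDerivWithin_extDerivWithin_apply (hw.contDiffWithinAt x hy) minSmoothness_two_le_infty I.uniqueDiffOn
    (I.range_subset_closure_interior hyr) hyr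

theorem contDiffOn_comp_extChartAt_symm {f : M → ℝ} (hf : ContMDiff I 𝓘(ℝ, ℝ) ∞ f) (x₀ : M) :
    ContDiffOn ℝ ∞ (fun y => f ((extChartAt I x₀).symm y)) (extChartAt I x₀).target :=
  (hf.comp_contMDiffOn (contMDiffOn_extChartAt_symm x₀)).contDiffOn

omit [IsManifold I ∞ M] in
theorem mvfderiv_eq_fderivWithin {f : M → ℝ} {x : M} (hf : MDifferentiableAt I 𝓘(ℝ, ℝ) f x) :
    mvfderiv I f x
      = fderivWithin ℝ (fun y => f ((extChartAt I x).symm y)) (range I) (extChartAt I x x) := by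
  ext u
  simp only [mvfderiv, hf.mfderiv]
  rfl

theorem differentiableWithinAt_comp_extChartAt_symm {f : M → ℝ} (hf : ContMDiff I 𝓘(ℝ, ℝ) ∞ f)
    (x₀ : M) {y : E} (hy : y ∈ (extChartAt I x₀).target) :
    DifferentiableWithinAt ℝ (fun y => f ((extChartAt I x₀).symm y)) (range I) y :=
  ((contDiffOn_comp_extChartAt_symm hf x₀).differentiableOn (by simp) y hy).mono_of_mem_nhdsWithin
    (extChartAt_target_mem_nhdsWithin_of_mem hy)

theorem smoothForm_zeroForm {f : M → ℝ} (hf : ContMDiff I 𝓘(ℝ, ℝ) ∞ f) :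
    SmoothForm I (zeroForm f : DForm E M 0) := fun x₀ =>
  (ContinuousAlternatingMap.constOfIsEmptyLIE ℝ E ℝ (Fin 0)).contDiff.comp_contDiffOn
    (contDiffOn_comp_extChartAt_symm hf x₀)

theorem extD_zeroForm {f : M → ℝ} (hf : ContMDiff I 𝓘(ℝ, ℝ) ∞ f) :
    extD I (zeroForm f) = dFun I f := by
  funext x
  rw [extD, inChart_zeroForm, extDerivWithin_constOfIsEmpty _
    (uniqueDiffWithinAt_range (mem_extChartAt_target x)), dFun,
    mvfderiv_eq_fderivWithin (hf.mdifferentiableAt (by simp))]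
  rfl

theorem smoothForm_dFun {f : M → ℝ} (hf : ContMDiff I 𝓘(ℝ, ℝ) ∞ f) :
    SmoothForm I (dFun I f : DForm E M 1) := by
  rw [← extD_zeroForm hf]
  exact (smoothForm_zeroForm hf).extD

theorem extD_dFun {f : M → ℝ} (hf : ContMDiff I 𝓘(ℝ, ℝ) ∞ f) :
    extD I (dFun I f : DForm E M 1) = 0 := by
  rw [← extD_zeroForm hf, extD_extD (smoothForm_zeroForm hf)]

theorem SmoothForm.fun_smul {f : M → ℝ} {w : DForm E M k} (hf : ContMDiff I 𝓘(ℝ, ℝ) ∞ f)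
    (hw : SmoothForm I w) : SmoothForm I (fun x => f x • w x) := fun x₀ =>
  (contDiffOn_comp_extChartAt_symm hf x₀).smul (hw x₀)

theorem SmoothForm.wedge {α : DForm E M 1} {w : DForm E M k} (hα : SmoothForm I α)
    (hw : SmoothForm I w) : SmoothForm I (wedge α w) := fun x₀ => by
  rw [inChart_wedge]
  exact ((wedgeL (V := E) k).contDiff.comp_contDiffOn (hα x₀)).clm_apply (hw x₀)

theorem SmoothForm.sub {w w' : DForm E M k} (hw : SmoothForm I w) (hw' : SmoothForm I w') :
    SmoothForm I (w - w') := by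
  rw [sub_eq_add_neg, ← neg_one_smul ℝ w']
  exact hw.add I (hw'.smul I _)

theorem extD_sub {w w' : DForm E M k} (hw : SmoothForm I w) (hw' : SmoothForm I w') :
    extD I (w - w') = extD I w - extD I w' := by
  rw [sub_eq_add_neg, ← neg_one_smul ℝ w', extD_add I hw (hw'.smul I _), extD_smul,
    sub_eq_add_neg]
  exact congrArg _ (neg_one_smul ℝ (AristotelianHydro.extD I w'))

theorem extD_fun_smul {f : M → ℝ} {w : DForm E M k} (hf : ContMDiff I 𝓘(ℝ, ℝ) ∞ f)
    (hw : SmoothForm I w) :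
    extD I (fun x => f x • w x) = wedge (dFun I f) w + fun x => f x • extD I w x := by
  funext x
  have hy := mem_extChartAt_target (I := I) x
  rw [extD, inChart_fun_smul, extDerivWithin_fun_smul_form
    (differentiableWithinAt_comp_extChartAt_symm hf x hy) (hw.differentiableWithinAt I x)
    (uniqueDiffWithinAt_range hy), inChart_self, extChartAt_to_inv,
    ← mvfderiv_eq_fderivWithin (hf.mdifferentiableAt (by simp))]
  rfl

theorem extD_wedge {α a b : DForm E M 1} {w : DForm E M k} (hα : SmoothForm I α)
    (hw : SmoothForm I w) (hab : extD I α = wedge a b) :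
    extD I (wedge α w) = wedge a (wedge b w) - wedge α (extD I w) := by
  funext x
  rw [extD, inChart_wedge, extDerivWithin_wedgePt (hα.differentiableWithinAt I x)
    (hw.differentiableWithinAt I x) (uniqueDiffWithinAt_range (mem_extChartAt_target x))
    (a := a x) (b := b x) (congrFun hab x), inChart_self, inChart_self]
  rfl

theorem contDiffOn_vectorInChart {X : (x : M) → TangentSpace I x}
    (hX : ContMDiff I I.tangent ∞ (fun x => (⟨x, X x⟩ : TangentBundle I M))) (x₀ : M) :
    ContDiffOn ℝ ∞ (vectorInChart I x₀ X) (extChartAt I x₀).target := by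
  have h1 := hX.comp_contMDiffOn (contMDiffOn_extChartAt_symm (n := ∞) x₀)
  have h2 := ((trivializationAt E (TangentSpace I) x₀).contMDiffOn_iff (fun y hy => by
    rw [TangentBundle.trivializationAt_source]
    simpa using (extChartAt I x₀).map_target hy)).1 h1
  exact h2.2.contDiffOn

theorem SmoothForm.interiorProd {X : (x : M) → TangentSpace I x} {w : DForm E M (k + 1)}
    (hX : ContMDiff I I.tangent ∞ (fun x => (⟨x, X x⟩ : TangentBundle I M)))
    (hw : SmoothForm I w) : SmoothForm I (interiorProd I X w) := fun x₀ => by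
  refine ContDiffOn.congr ?_ fun y hy => inChart_interiorProd x₀ X w hy
  exact ((ContinuousAlternatingMap.curryLeftLI (𝕜 := ℝ) (E := E) (F := ℝ)
    (n := k)).contDiff.comp_contDiffOn (hw x₀)).clm_apply (contDiffOn_vectorInChart hX x₀)

end Charts

/-! ### The Godbillon-Vey class -/

section GodbillonVey

variable {E : Type*} [NormedAddCommGroup E] [NormedSpace ℝ E]
  {H : Type*} [TopologicalSpace H] {I : ModelWithCorners ℝ E H}
  {M : Type*} [TopologicalSpace M] [ChartedSpace H M] [IsManifold I ∞ M] {k : ℕ}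

theorem contMDiff_of_contDiffOn_comp_extChartAt_symm {f : M → ℝ}
    (hf : ∀ x₀, ContDiffOn ℝ ∞ (fun y => f ((extChartAt I x₀).symm y)) (extChartAt I x₀).target) :
    ContMDiff I 𝓘(ℝ, ℝ) ∞ f := by
  intro x
  have h1 : ContMDiffOn I 𝓘(ℝ, ℝ) ∞
      ((fun y => f ((extChartAt I x).symm y)) ∘ extChartAt I x) (chartAt H x).source :=
    (hf x).contMDiffOn.comp contMDiffOn_extChartAt fun y hy =>
      (extChartAt I x).map_source (by rwa [extChartAt_source])
  have h2 : ContMDiffOn I 𝓘(ℝ, ℝ) ∞ f (chartAt H x).source := h1.congr fun y hy => by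
    rw [Function.comp_apply, (extChartAt I x).left_inv (by rwa [extChartAt_source])]
  exact h2.contMDiffAt ((chartAt H x).open_source.mem_nhds (mem_chart_source H x))

theorem SmoothForm.contMDiff_apply {α : DForm E M 1} {X : (x : M) → TangentSpace I x}
    (hα : SmoothForm I α)
    (hX : ContMDiff I I.tangent ∞ (fun x => (⟨x, X x⟩ : TangentBundle I M))) :
    ContMDiff I 𝓘(ℝ, ℝ) ∞ (fun x => toCovector (V := E) (α x) (X x)) := by
  refine contMDiff_of_contDiffOn_comp_extChartAt_symm fun x₀ => ?_
  have h := (ContinuousAlternatingMap.constOfIsEmptyLIE ℝ E ℝ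
    (Fin 0)).symm.contDiff.comp_contDiffOn (hα.interiorProd hX x₀)
  refine h.congr fun y _ => ?_
  exact (curryLeft_one_apply (V := E) (α ((extChartAt I x₀).symm y))
    (X ((extChartAt I x₀).symm y)) _).symm

omit [IsManifold I ∞ M] in
theorem interiorProd_wedge_one (X : (x : M) → TangentSpace I x) (α β : DForm E M 1) :
    interiorProd I X (wedge α β) = fun x => toCovector (V := E) (α x) (X x) • β x
      - toCovector (V := E) (β x) (X x) • α x :=
  funext fun x => curryLeft_wedgePt_one (V := E) (α x) (β x) (X x)

omit [IsManifold I ∞ M] in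
theorem interiorProd_wedge (X : (x : M) → TangentSpace I x) (α : DForm E M 1)
    (w : DForm E M (k + 1)) :
    interiorProd I X (wedge α w) = fun x => toCovector (V := E) (α x) (X x) • w x
      - wedge α (interiorProd I X w) x :=
  funext fun x => curryLeft_wedgePt (V := E) (α x) (w x) (X x)

theorem deRhamClass_eq_of_eq_add_extD {w w' : DForm E M (k + 1)} (hw : w ∈ closedForms I M (k + 1))
    (hw' : w' ∈ closedForms I M (k + 1)) {θ : DForm E M k} (hθ : SmoothForm I θ)
    (h : w' = w + extD I θ) : deRhamClass I w hw = deRhamClass I w' hw' := by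
  refine QuotientAddGroup.eq.2 ⟨θ, hθ, ?_⟩
  simp [h]

theorem deRhamClass_eq_zero {w : DForm E M (k + 1)} (hw : w ∈ closedForms I M (k + 1))
    (h : w = 0) : deRhamClass I w hw = 0 := by
  subst h
  rfl

theorem wedge_extD_eq_zero {η α : DForm E M 1} (hη : SmoothForm I η) (hα : SmoothForm I α)
    (hd : extD I η = wedge η α) : wedge η (extD I α) = 0 := by
  have h := extD_extD hη
  rw [hd, extD_wedge hη hα hd] at h
  have h1 : wedge η (wedge α α) = 0 := funext fun x => by
    simp [wedge, wedgePt_self, wedgePt_zero_right]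
  rwa [h1, zero_sub, neg_eq_zero] at h

variable {X : (x : M) → TangentSpace I x} {η α β : DForm E M 1}

theorem extD_eq_wedge_interiorProd (hη : SmoothForm I η) (hα : SmoothForm I α)
    (hηX : ∀ x, toCovector (V := E) (η x) (X x) = 1) (hd : extD I η = wedge η α) :
    extD I α = wedge η (interiorProd I X (extD I α)) := by
  have h := congrArg (interiorProd I X) (wedge_extD_eq_zero hη hα hd)
  rw [interiorProd_wedge] at h
  funext x
  have hx := congrFun h x
  simp only [hηX, one_smul] at hx
  exact sub_eq_zero.1 hx

theorem wedge_extD_mem_closedForms (hη : SmoothForm I η) (hα : SmoothForm I α)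
    (hηX : ∀ x, toCovector (V := E) (η x) (X x) = 1) (hd : extD I η = wedge η α) :
    wedge α (extD I α) ∈ closedForms I M 3 := by
  refine ⟨hα.wedge hα.extD, ?_⟩
  rw [extD_wedge hα hα.extD (extD_eq_wedge_interiorProd hη hα hηX hd), extD_extD hα]
  funext x
  have h := congrFun (wedge_extD_eq_zero hη hα hd) x
  simp only [wedge, Pi.zero_apply] at h
  simp only [wedge, Pi.sub_apply, Pi.zero_apply, wedgePt_zero_right, sub_zero]
  rw [wedgePt_swap, h, wedgePt_zero_right, neg_zero]

omit [IsManifold I ∞ M] in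
/-- Two one-forms `α`, `β` with `η ∧ α = η ∧ β` differ by a multiple of `η`. -/
theorem eq_add_smul_of_wedge_eq (hηX : ∀ x, toCovector (V := E) (η x) (X x) = 1)
    (h : wedge η α = wedge η β) :
    β = α + fun x => toCovector (V := E) ((β - α) x) (X x) • η x := by
  funext x
  have h1 := congrFun (congrArg (interiorProd I X) h) x
  rw [interiorProd_wedge_one, interiorProd_wedge_one] at h1
  simp only [hηX, one_smul] at h1
  have key : ∀ (a b e : E [⋀^Fin 1]→L[ℝ] ℝ) (r s : ℝ), a - s • e = b - r • e →
      b = a + (r - s) • e := fun a b e r s h => by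
    ext v
    have hv := congrArg (fun w => w v) h
    simp only [ContinuousAlternatingMap.add_apply, ContinuousAlternatingMap.sub_apply,
      ContinuousAlternatingMap.smul_apply, smul_eq_mul] at hv ⊢
    linarith
  exact key _ _ _ _ _ h1

theorem wedge_extD_add_smul {f : M → ℝ} (hf : ContMDiff I 𝓘(ℝ, ℝ) ∞ f) (hη : SmoothForm I η)
    (hα : SmoothForm I α) (hd : extD I η = wedge η α) :
    wedge (α + fun x => f x • η x) (extD I (α + fun x => f x • η x))
      = wedge α (extD I α) + extD I (fun x => f x • extD I η x) := by
  rw [extD_add I hα (hη.fun_smul hf), extD_fun_smul hf hη, extD_fun_smul hf hη.extD, extD_extD hη,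
    hd]
  funext x
  have h := congrFun (wedge_extD_eq_zero hη hα hd) x
  simp only [wedge, Pi.zero_apply] at h
  simp only [wedge, Pi.add_apply, Pi.zero_apply, smul_zero, add_zero, wedgePt_add_left,
    wedgePt_add_right, wedgePt_smul_left, wedgePt_smul_right, h, wedgePt_wedgePt_self]
  rw [wedgePt_cycle (α x) (dFun I f x) (η x), wedgePt_swap (α x) (η x) (α x), wedgePt_self,
    wedgePt_comm (dFun I f x) (η x), wedgePt_neg_right, wedgePt_wedgePt_self]
  simp [wedgePt_zero_right]

/-- If `η` takes the value one on some smooth vector field, then each smooth one-form `α` with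
`dη = η ∧ α` computes the Godbillon-Vey class of `η`. -/
theorem isGodbillonVeyClass_deRhamClass
    (hX : ContMDiff I I.tangent ∞ (fun x => (⟨x, X x⟩ : TangentBundle I M)))
    (hη : SmoothForm I η) (hα : SmoothForm I α)
    (hηX : ∀ x, toCovector (V := E) (η x) (X x) = 1) (hd : extD I η = wedge η α)
    (hcl : wedge α (extD I α) ∈ closedForms I M 3) :
    IsGodbillonVeyClass I η (deRhamClass I (wedge α (extD I α)) hcl) := by
  refine ⟨⟨α, hα, hd⟩, fun β hβ hdβ => ?_⟩
  have hclβ := wedge_extD_mem_closedForms hη hβ hηX hdβ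
  refine ⟨hclβ, ?_⟩
  have hf := (hβ.sub hα).contMDiff_apply hX
  symm
  refine deRhamClass_eq_of_eq_add_extD hcl hclβ (hη.extD.fun_smul hf) ?_
  rw [← wedge_extD_add_smul hf hη hα hd, ← eq_add_smul_of_wedge_eq hηX (hd.symm.trans hdβ)]

end GodbillonVey

/-! ### The exterior derivative of a one-form on vector fields -/

section LieBracket

variable {E : Type*} [NormedAddCommGroup E] [NormedSpace ℝ E]
  {H : Type*} [TopologicalSpace H] {I : ModelWithCorners ℝ E H}
  {M : Type*} [TopologicalSpace M] [ChartedSpace H M] [IsManifold I ∞ M]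

theorem mfderiv_extChartAt_eq_tangentCoordChange {x z : M} (hz : z ∈ (extChartAt I x).source) :
    mfderiv I 𝓘(ℝ, E) (extChartAt I x) z = tangentCoordChange I z x z := by
  rw [(mdifferentiableAt_extChartAt (by rwa [extChartAt_source] at hz)).mfderiv]
  rfl

theorem mpullbackWithin_extChartAt_symm (x : M) (X : (x : M) → TangentSpace I x) {y : E}
    (hy : y ∈ (extChartAt I x).target) :
    VectorField.mpullbackWithin 𝓘(ℝ, E) I (extChartAt I x).symm X (range I) y
      = vectorInChart I x X y := by
  rw [VectorField.mpullbackWithin_apply, ContinuousLinearMap.inverse_eq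
    (mfderivWithin_extChartAt_symm_comp_mfderiv_extChartAt hy)
    (mfderiv_extChartAt_comp_mfderivWithin_extChartAt_symm hy),
    mfderiv_extChartAt_eq_tangentCoordChange ((extChartAt I x).map_target hy)]
  rfl

theorem mlieBracket_eq_lieBracketWithin (x : M) (X Y : (x : M) → TangentSpace I x) :
    VectorField.mlieBracket I X Y x = VectorField.lieBracketWithin ℝ (vectorInChart I x X)
      (vectorInChart I x Y) (range I) (extChartAt I x x) := by
  have h : ∀ Z : (x : M) → TangentSpace I x,
      VectorField.mpullbackWithin 𝓘(ℝ, E) I (extChartAt I x).symm Z (range I)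
        =ᶠ[𝓝[range I] (extChartAt I x x)] vectorInChart I x Z := fun Z => by
    filter_upwards [extChartAt_target_mem_nhdsWithin x] with y hy
    exact mpullbackWithin_extChartAt_symm x Z hy
  have hid : ∀ u : E, (mfderiv I 𝓘(ℝ, E) (extChartAt I x) x).inverse u = u := fun u => by
    rw [mfderiv_extChartAt_self]
    exact congrArg (fun L : E →L[ℝ] E => L u) (ContinuousLinearMap.inverse_id (R := ℝ) (M := E))
  have hset : (extChartAt I x).symm ⁻¹' univ ∩ range I = range I := by simp
  rw [← VectorField.mlieBracketWithin_univ, VectorField.mlieBracketWithin_apply, hset]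
  refine (hid _).trans ?_
  exact (h X).lieBracketWithin_vectorField_eq_of_mem (h Y) (extChartAt_target_subset_range x
    (mem_extChartAt_target x))

theorem DiffVectorAt.differentiableWithinAt_vectorInChart {X : (x : M) → TangentSpace I x} {x : M}
    (hX : DiffVectorAt X x) :
    DifferentiableWithinAt ℝ (vectorInChart I x X) (range I) (extChartAt I x x) := by
  have h := (mdifferentiableAt_totalSpace I (F := E) (E := TangentSpace I)
    (fun y => (⟨y, X y⟩ : TangentBundle I M))).1 hX
  have h2 := h.2
  rw [← mdifferentiableWithinAt_univ] at h2
  have h3 := h2.differentiableWithinAt_comp_extChartAt_symm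
  rw [preimage_univ, univ_inter] at h3
  exact h3

theorem toCovector_inChart_vectorInChart (x : M) (η : DForm E M 1)
    (X : (x : M) → TangentSpace I x) {y : E} (hy : y ∈ (extChartAt I x).target) :
    toCovector (inChart I x η y) (vectorInChart I x X y)
      = toCovector (V := E) (η ((extChartAt I x).symm y)) (X ((extChartAt I x).symm y)) := by
  exact congrArg (η ((extChartAt I x).symm y)) (funext fun _ =>
    tangentCoordChange_symm_apply ((extChartAt I x).map_target hy) _)

theorem mvfderiv_toCovector {η : DForm E M 1} (hη : SmoothForm I η)
    {X : (x : M) → TangentSpace I x} {x : M} (hX : DiffVectorAt X x) (u : E) :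
    mvfderiv I (fun y => toCovector (V := E) (η y) (X y)) x u
      = toCovector (fderivWithin ℝ (inChart I x η) (range I) (extChartAt I x x) u) (X x)
        + toCovector (η x) (fderivWithin ℝ (vectorInChart I x X) (range I)
          (extChartAt I x x) u) := by
  have hy := mem_extChartAt_target (I := I) x
  have hηd := hη.differentiableWithinAt I x
  have hXd := hX.differentiableWithinAt_vectorInChart
  have heq : (fun y => toCovector (V := E) (η ((extChartAt I x).symm y))
      (X ((extChartAt I x).symm y))) =ᶠ[𝓝[range I] (extChartAt I x x)]
      fun y => toCovectorL (inChart I x η y) (vectorInChart I x X y) := by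
    filter_upwards [extChartAt_target_mem_nhdsWithin x] with y hy
    exact (toCovector_inChart_vectorInChart x η X hy).symm
  have hyr : extChartAt I x x ∈ range I := extChartAt_target_subset_range x hy
  have hd : HasFDerivWithinAt (fun y => toCovectorL (inChart I x η y) (vectorInChart I x X y)) _
      (range I) (extChartAt I x x) := ContinuousLinearMap.hasFDerivWithinAt_of_bilinear
    (toCovectorL (V := E)) hηd.hasFDerivWithinAt hXd.hasFDerivWithinAt
  have hm : MDifferentiableAt I 𝓘(ℝ, ℝ) (fun y => toCovector (V := E) (η y) (X y)) x := by
    rw [← mdifferentiableWithinAt_univ]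
    apply DifferentiableWithinAt.mdifferentiableWithinAt_of_comp_extChartAt_symm
    rw [preimage_univ, univ_inter]
    exact hd.differentiableWithinAt.congr_of_eventuallyEq_of_mem heq hyr
  rw [mvfderiv_eq_fderivWithin hm, heq.fderivWithin_eq_of_mem hyr,
    hd.fderivWithin (uniqueDiffWithinAt_range hy), inChart_self, vectorInChart_self, add_comm]
  rfl

/-- The formula `dη(X, Y) = X(η(Y)) - Y(η(X)) - η([X, Y])`. -/
theorem extD_apply_eq_sub_mlieBracket {η : DForm E M 1} (hη : SmoothForm I η)
    {X Y : (x : M) → TangentSpace I x} {x : M} (hX : DiffVectorAt X x) (hY : DiffVectorAt Y x) :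
    toCovector ((extD I η x).curryLeft (X x)) (Y x)
      = mvfderiv I (fun y => toCovector (V := E) (η y) (Y y)) x (X x)
        - mvfderiv I (fun y => toCovector (V := E) (η y) (X y)) x (Y x)
        - toCovector (V := E) (η x) (VectorField.mlieBracket I X Y x) := by
  have key : ∀ (B : E →L[ℝ] E [⋀^Fin 1]→L[ℝ] ℝ) (u w : E),
      toCovector ((ContinuousAlternatingMap.alternatizeUncurryFin B).curryLeft u) w
        = toCovector (B u) w - toCovector (B w) u := fun B u w => by
    rw [toCovector_apply, ContinuousAlternatingMap.curryLeft_apply_apply,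
      alternatizeUncurryFin_toCovector_apply]
    rfl
  have h1 := mvfderiv_toCovector hη hY (X x)
  have h2 := mvfderiv_toCovector hη hX (Y x)
  have h3 : toCovector (V := E) (η x) (VectorField.mlieBracket I X Y x)
      = toCovector (V := E) (η x) (fderivWithin ℝ (vectorInChart I x Y) (range I)
          (extChartAt I x x) (X x))
        - toCovector (V := E) (η x) (fderivWithin ℝ (vectorInChart I x X) (range I)
          (extChartAt I x x) (Y x)) := by
    rw [mlieBracket_eq_lieBracketWithin, VectorField.lieBracketWithin, vectorInChart_self,
      vectorInChart_self]
    exact map_sub _ _ _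
  have h4 : toCovector (V := E) ((extD I η x).curryLeft (X x)) (Y x)
      = toCovector (V := E) (fderivWithin ℝ (inChart I x η) (range I)
          (extChartAt I x x) (X x)) (Y x)
        - toCovector (V := E) (fderivWithin ℝ (inChart I x η) (range I)
          (extChartAt I x x) (Y x)) (X x) :=
    key _ (X x) (Y x)
  linarith

end LieBracket

/-! ### Exchanging the time derivative with derivatives in space -/

section MixedPartials

variable {E G : Type*} [NormedAddCommGroup E] [NormedSpace ℝ E]
  [NormedAddCommGroup G] [NormedSpace ℝ G] {J : Set ℝ} {T : Set E} {Φ : ℝ × E → G} {t : ℝ} {y : E}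

theorem ContDiffOn.hasDerivAt_left (hΦ : ContDiffOn ℝ ∞ Φ (J ×ˢ T)) (hJ : IsOpen J)
    (ht : t ∈ J) (hy : y ∈ T) :
    HasDerivAt (fun s => Φ (s, y)) (fderivWithin ℝ Φ (J ×ˢ T) (t, y) (1, 0)) t := by
  have h1 := (hΦ.differentiableOn (by simp) (t, y) ⟨ht, hy⟩).hasFDerivWithinAt
  have h2 : HasFDerivWithinAt (fun s : ℝ => (s, y)) (ContinuousLinearMap.inl ℝ ℝ E) J t :=
    (hasFDerivAt_prodMk_left t y).hasFDerivWithinAt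
  have hmaps : MapsTo (fun s : ℝ => (s, y)) J (J ×ˢ T) := fun s hs => ⟨hs, hy⟩
  have h3 := (h1.comp t h2 hmaps).hasFDerivAt (hJ.mem_nhds ht)
  exact h3.hasDerivAt

theorem ContDiffOn.hasFDerivWithinAt_right (hΦ : ContDiffOn ℝ ∞ Φ (J ×ˢ T))
    (ht : t ∈ J) (hy : y ∈ T) :
    HasFDerivWithinAt (fun z => Φ (t, z))
      (fderivWithin ℝ Φ (J ×ˢ T) (t, y) ∘L ContinuousLinearMap.inr ℝ ℝ E) T y := by
  have h1 := (hΦ.differentiableOn (by simp) (t, y) ⟨ht, hy⟩).hasFDerivWithinAt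
  have h2 : HasFDerivWithinAt (fun z : E => (t, z)) (ContinuousLinearMap.inr ℝ ℝ E) T y :=
    (hasFDerivAt_prodMk_right t y).hasFDerivWithinAt
  exact h1.comp y h2 fun z hz => ⟨ht, hz⟩

/-- For a smooth map on a product of time and space, the time derivative of the space derivative is
the space derivative of the time derivative. -/
theorem ContDiffOn.hasDerivAt_fderivWithin (hΦ : ContDiffOn ℝ ∞ Φ (J ×ˢ T)) (hJ : IsOpen J)
    (hT : UniqueDiffOn ℝ T) (ht : t ∈ J) (hy : y ∈ T) (hyc : y ∈ closure (interior T)) :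
    HasDerivAt (fun s => fderivWithin ℝ (fun z => Φ (s, z)) T y)
      (fderivWithin ℝ (fun z => deriv (fun s => Φ (s, z)) t) T y) t := by
  have hS : UniqueDiffOn ℝ (J ×ˢ T) := hJ.uniqueDiffOn.prod hT
  have hD : ContDiffOn ℝ ∞ (fderivWithin ℝ Φ (J ×ˢ T)) (J ×ˢ T) :=
    hΦ.fderivWithin hS (by simp)
  have hsymm : IsSymmSndFDerivWithinAt ℝ Φ (J ×ˢ T) (t, y) :=
    (hΦ (t, y) ⟨ht, hy⟩).isSymmSndFDerivWithinAt minSmoothness_two_le_infty hS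
      (by
        rw [interior_prod_eq, closure_prod_eq, hJ.interior_eq]
        exact ⟨subset_closure ht, hyc⟩) ⟨ht, hy⟩
  have h1 : HasDerivAt (fun s => fderivWithin ℝ (fun z => Φ (s, z)) T y)
      (fderivWithin ℝ (fderivWithin ℝ Φ (J ×ˢ T)) (J ×ˢ T) (t, y) (1, 0)
        ∘L ContinuousLinearMap.inr ℝ ℝ E) t := by
    have h := (hD.hasDerivAt_left hJ ht hy).clm_comp
      (hasDerivAt_const t (ContinuousLinearMap.inr ℝ ℝ E))
    rw [ContinuousLinearMap.comp_zero, add_zero] at h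
    refine h.congr_of_eventuallyEq ?_
    filter_upwards [hJ.mem_nhds ht] with s hs
    exact (hΦ.hasFDerivWithinAt_right hs hy).fderivWithin (hT y hy)
  convert! h1 using 1
  have h2 : EqOn (fun z => deriv (fun s => Φ (s, z)) t)
      (fun z => fderivWithin ℝ Φ (J ×ˢ T) (t, z) (1, 0)) T := fun z hz =>
    (hΦ.hasDerivAt_left hJ ht hz).deriv
  rw [fderivWithin_congr h2 (h2 hy)]
  have h3 := ((hD.hasFDerivWithinAt_right ht hy).clm_apply
    (hasFDerivWithinAt_const ((1 : ℝ), (0 : E)) y T)).fderivWithin (hT y hy)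
  rw [h3]
  ext u
  simpa using hsymm (0, u) (1, 0)

end MixedPartials

section Families

variable {E : Type*} [NormedAddCommGroup E] [NormedSpace ℝ E]
  {H : Type*} [TopologicalSpace H] {I : ModelWithCorners ℝ E H}
  {M : Type*} [TopologicalSpace M] [ChartedSpace H M] [IsManifold I ∞ M] {k : ℕ}
  {J : Set ℝ} {w : ℝ → DForm E M k} {t : ℝ}

theorem SmoothFormFamily.smoothForm (hw : SmoothFormFamily I J w) (ht : t ∈ J) :
    SmoothForm I (w t) := fun x₀ =>
  (hw x₀).comp (contDiffOn_const.prodMk contDiffOn_id) fun _ hy => ⟨ht, hy⟩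

theorem SmoothFormFamily.differentiableAt (hw : SmoothFormFamily I J w) (hJ : IsOpen J)
    (ht : t ∈ J) (x : M) : DifferentiableAt ℝ (fun s => w s x) t := by
  have h := (hw x).hasDerivAt_left hJ ht (mem_extChartAt_target x)
  simp only [inChart_self] at h
  exact h.differentiableAt

/-- The exterior derivative commutes with the time derivative. -/
theorem SmoothFormFamily.extD_deriv (hw : SmoothFormFamily I J w) (hJ : IsOpen J) (ht : t ∈ J)
    (x : M) :
    extD I (fun y => deriv (fun s => w s y) t) x = deriv (fun s => extD I (w s) x) t := by
  have hy := mem_extChartAt_target (I := I) x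
  have hnhds := extChartAt_target_mem_nhdsWithin (I := I) x
  have hchart : inChart I x (fun y => deriv (fun s => w s y) t)
      = fun y => deriv (fun s => inChart I x (w s) y) t := by
    funext y
    exact ((ContinuousAlternatingMap.compContinuousLinearMapCLM (F := ℝ) (ι := Fin k)
      (tangentCoordChange I x ((extChartAt I x).symm y)
        ((extChartAt I x).symm y))).hasFDerivAt.comp_hasDerivAt t
      (hw.differentiableAt hJ ht _).hasDerivAt).deriv.symm
  have hset : ∀ f : E → E [⋀^Fin k]→L[ℝ] ℝ,
      fderivWithin ℝ f (range I) (extChartAt I x x)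
        = fderivWithin ℝ f (extChartAt I x).target (extChartAt I x x) := fun f =>
    fderivWithin_congr_set 
      (nhdsWithin_eq_iff_eventuallyEq.1 (nhdsWithin_extChartAt_target_eq x).symm)
  have h := (hw x).hasDerivAt_fderivWithin hJ (uniqueDiffOn_extChartAt_target x) ht hy
    (extChartAt_target_subset_closure_interior hy)
  have h' := ((ContinuousAlternatingMap.alternatizeUncurryFinCLM ℝ E ℝ).hasFDerivAt.comp_hasDerivAt
    t h).deriv
  simp only [extD, extDerivWithin, hchart, hset]
  exact h'.symm

end Families

/-! ### Smooth functions -/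

section Functions

variable {E : Type*} [NormedAddCommGroup E] [NormedSpace ℝ E]
  {H : Type*} [TopologicalSpace H] {I : ModelWithCorners ℝ E H}
  {M : Type*} [TopologicalSpace M] [ChartedSpace H M] [IsManifold I ∞ M] {J : Set ℝ} {t : ℝ}

omit [IsManifold I ∞ M] in
theorem contMDiff_slice {f : ℝ × M → ℝ}
    (hf : ContMDiffOn (𝓘(ℝ, ℝ).prod I) 𝓘(ℝ, ℝ) ∞ f (J ×ˢ univ)) (ht : t ∈ J) :
    ContMDiff I 𝓘(ℝ, ℝ) ∞ (fun x => f (t, x)) := by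
  rw [← contMDiffOn_univ]
  exact hf.comp (contMDiffOn_const.prodMk contMDiffOn_id) fun x _ => ⟨ht, mem_univ x⟩

theorem contDiffOn_comp_extChartAt_symm_family {f : ℝ × M → ℝ}
    (hf : ContMDiffOn (𝓘(ℝ, ℝ).prod I) 𝓘(ℝ, ℝ) ∞ f (J ×ˢ univ)) (x₀ : M) :
    ContDiffOn ℝ ∞ (fun q : ℝ × E => f (q.1, (extChartAt I x₀).symm q.2))
      (J ×ˢ (extChartAt I x₀).target) := by
  have h1 : ContMDiffOn 𝓘(ℝ, ℝ × E) 𝓘(ℝ, ℝ) ∞ (fun q : ℝ × E => q.1)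
      (J ×ˢ (extChartAt I x₀).target) := contDiff_fst.contMDiff.contMDiffOn
  have h2 : ContMDiffOn 𝓘(ℝ, ℝ × E) I ∞ (fun q : ℝ × E => (extChartAt I x₀).symm q.2)
      (J ×ˢ (extChartAt I x₀).target) :=
    (contMDiffOn_extChartAt_symm x₀).comp contDiff_snd.contMDiff.contMDiffOn fun q hq => hq.2
  exact (hf.comp (h1.prodMk h2) fun q hq => ⟨hq.1, mem_univ _⟩).contDiffOn

omit [IsManifold I ∞ M] in
theorem dFun_const (c : ℝ) : (dFun I (fun _ : M => c) : DForm E M 1) = 0 := by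
  funext x
  rw [dFun, mvfderiv_const]
  rfl

theorem contMDiff_log {f : M → ℝ} (hf : ContMDiff I 𝓘(ℝ, ℝ) ∞ f) (hf0 : ∀ x, f x ≠ 0) :
    ContMDiff I 𝓘(ℝ, ℝ) ∞ (fun x => Real.log (f x)) :=
  contMDiff_of_contDiffOn_comp_extChartAt_symm fun x₀ =>
    (contDiffOn_comp_extChartAt_symm hf x₀).log fun _ _ => hf0 _

theorem contMDiff_inv {f : M → ℝ} (hf : ContMDiff I 𝓘(ℝ, ℝ) ∞ f) (hf0 : ∀ x, f x ≠ 0) :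
    ContMDiff I 𝓘(ℝ, ℝ) ∞ (fun x => (f x)⁻¹) :=
  contMDiff_of_contDiffOn_comp_extChartAt_symm fun x₀ =>
    (contDiffOn_comp_extChartAt_symm hf x₀).inv fun _ _ => hf0 _

theorem dFun_log {f : M → ℝ} (hf : ContMDiff I 𝓘(ℝ, ℝ) ∞ f) (hf0 : ∀ x, f x ≠ 0) (x : M) :
    dFun I (fun x => Real.log (f x)) x = (f x)⁻¹ • (dFun I f x : E [⋀^Fin 1]→L[ℝ] ℝ) := by
  have hy := mem_extChartAt_target (I := I) x
  rw [dFun, mvfderiv_eq_fderivWithin ((contMDiff_log hf hf0).mdifferentiableAt (by simp)),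
    fderivWithin.log (differentiableWithinAt_comp_extChartAt_symm hf x hy) (hf0 _)
      (uniqueDiffWithinAt_range hy), ← mvfderiv_eq_fderivWithin (hf.mdifferentiableAt (by simp)),
    extChartAt_to_inv]
  rfl

end Functions

/-! ### Smoothness of the fields of a fluid -/

section Fluid

variable {E : Type*} [NormedAddCommGroup E] [NormedSpace ℝ E] [FiniteDimensional ℝ E]
  {H : Type*} [TopologicalSpace H] {I : ModelWithCorners ℝ E H}
  {M : Type*} [TopologicalSpace M] [ChartedSpace H M] [IsManifold I ∞ M] {k : ℕ} {J : Set ℝ}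
  {t : ℝ}

theorem IdealFluid.contMDiff_v (F : IdealFluid I M k J) (ht : t ∈ J) :
    ContMDiff I I.tangent ∞ (fun x => (⟨x, F.v t x⟩ : TangentBundle I M)) := by
  rw [← contMDiffOn_univ]
  exact F.v_smooth.comp (contMDiffOn_const.prodMk contMDiffOn_id) fun x _ => ⟨ht, mem_univ x⟩

theorem IdealFluid.diffVectorAt_v (F : IdealFluid I M k J) (ht : t ∈ J) (x : M) :
    DiffVectorAt (F.v t) x :=
  (F.contMDiff_v ht).mdifferentiableAt (by simp)

theorem IdealFluid.differentiableAt_v (F : IdealFluid I M k J) (hJ : IsOpen J) (ht : t ∈ J)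
    (x : M) : DifferentiableAt ℝ (F := E) (fun s => F.v s x) t := by
  have h1 : ContMDiffOn 𝓘(ℝ, ℝ) I.tangent ∞ (fun s => (⟨x, F.v s x⟩ : TangentBundle I M)) J :=
    F.v_smooth.comp (contMDiffOn_id.prodMk contMDiffOn_const) fun s hs => ⟨hs, mem_univ x⟩
  have h2 := ((trivializationAt E (TangentSpace I) x).contMDiffOn_iff (fun s _ => by
    rw [TangentBundle.trivializationAt_source]
    exact mem_chart_source H x)).1 h1
  have h3 : DifferentiableAt ℝ (fun s => tangentCoordChange I x x x (F.v s x)) t :=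
    (h2.2.contDiffOn.differentiableOn (by simp)).differentiableAt (hJ.mem_nhds ht)
  have h4 : ∀ u : E, tangentCoordChange I x x x u = u :=
    fun u => tangentCoordChange_self (mem_extChartAt_source x)
  exact h3.congr_of_eventuallyEq (Filter.EventuallyEq.of_eq (funext fun s => (h4 _).symm))

theorem IdealFluid.contMDiffOn_speed (F : IdealFluid I M k J) :
    ContMDiffOn (𝓘(ℝ, ℝ).prod I) 𝓘(ℝ, ℝ) ∞ (fun q : ℝ × M => F.speed q.1 q.2) (J ×ˢ univ) := by
  intro q hq
  have hb : ContMDiffWithinAt (𝓘(ℝ, ℝ).prod I) I ∞ (Prod.snd : ℝ × M → M) (J ×ˢ univ) q :=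
    contMDiffWithinAt_snd
  have h : ContMDiffWithinAt (𝓘(ℝ, ℝ).prod I) (I.prod 𝓘(ℝ)) ∞
      (fun q : ℝ × M => TotalSpace.mk' ℝ (E := Bundle.Trivial M ℝ) q.2
        (F.g.inner q.2 (F.v q.1 q.2) (F.v q.1 q.2))) (J ×ˢ univ) q := by
    apply ContMDiffWithinAt.clm_bundle_apply₂ (F₁ := E) (F₂ := E)
    · exact ContMDiffAt.comp_contMDiffWithinAt q F.g.contMDiff.contMDiffAt hb
    · exact F.v_smooth q hq
    · exact F.v_smooth q hq
  rw [contMDiffWithinAt_totalSpace] at h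
  exact h.2

theorem IdealFluid.contMDiff_speed (F : IdealFluid I M k J) (ht : t ∈ J) :
    ContMDiff I 𝓘(ℝ, ℝ) ∞ (F.speed t) :=
  contMDiff_slice F.contMDiffOn_speed ht

theorem AristotelianFluid.v_ne_zero (F : AristotelianFluid I M k J) (ht : t ∈ J) (x : M) :
    F.v t x ≠ 0 := fun h => by
  have h1 := F.τ_v t ht x
  rw [h, map_zero] at h1
  exact zero_ne_one h1

theorem AristotelianFluid.speed_pos (F : AristotelianFluid I M k J) (ht : t ∈ J) (x : M) :
    0 < F.speed t x :=
  F.g.pos x _ (F.v_ne_zero ht x)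

theorem AristotelianFluid.smoothForm_τ (F : AristotelianFluid I M k J) (ht : t ∈ J) :
    SmoothForm I (F.τ t) :=
  F.τ_smooth.smoothForm ht

theorem AristotelianFluid.vflat_eq (F : AristotelianFluid I M k J) (ht : t ∈ J) :
    F.vflat t = fun x => F.speed t x • F.τ t x := by
  funext x
  apply toCovector_injective
  have key : ∀ u : TangentSpace I x, F.g.inner x (F.v t x) u
      = F.speed t x * covectorAt I (F.τ t) x u := fun u => by
    have h := F.orthogonal t ht x (u - covectorAt I (F.τ t) x u • F.v t x) (by
      rw [map_sub, map_smul, F.τ_v t ht x]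
      simp)
    rw [F.g.symm, map_sub, map_smul, sub_eq_zero] at h
    rw [h, smul_eq_mul, mul_comm]
    rfl
  ext u
  exact key u

theorem AristotelianFluid.smoothFormFamily_vflat (F : AristotelianFluid I M k J) :
    SmoothFormFamily I J F.vflat := fun x₀ => by
  refine ((contDiffOn_comp_extChartAt_symm_family F.contMDiffOn_speed x₀).smul
    (F.τ_smooth x₀)).congr fun q hq => ?_
  rw [F.vflat_eq hq.1]
  rfl

/-! ### The one-forms `α` and `α_v` -/

theorem AristotelianFluid.alpha_eq (F : AristotelianFluid I M k J) (ht : t ∈ J) :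
    F.alpha t = interiorProd I (F.v t) (extD I (F.τ t)) := by
  have h : interiorProd I (F.v t) (F.τ t) = zeroForm fun _ => 1 := by
    funext x
    ext z
    exact (curryLeft_one_apply (V := E) (F.τ t x) (F.v t x) z).trans (F.τ_v t ht x)
  rw [AristotelianFluid.alpha, lieForm, h, extD_zeroForm contMDiff_const, dFun_const, zero_add]

theorem AristotelianFluid.smoothForm_alpha (F : AristotelianFluid I M k J) (ht : t ∈ J) :
    SmoothForm I (F.alpha t) := by
  rw [F.alpha_eq ht]
  exact (F.smoothForm_τ ht).extD.interiorProd (F.contMDiff_v ht)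

theorem AristotelianFluid.extD_τ (F : AristotelianFluid I M k J) (ht : t ∈ J) :
    extD I (F.τ t) = wedge (F.τ t) (F.alpha t) := by
  obtain ⟨α, -, hα⟩ := F.integrable t ht
  rw [F.alpha_eq ht, hα, interiorProd_wedge_one]
  funext x
  have hτ : toCovector (V := E) (F.τ t x) (F.v t x) = 1 := F.τ_v t ht x
  simp only [wedge, hτ, one_smul, wedgePt_sub_right, wedgePt_smul_right, wedgePt_self, smul_zero,
    sub_zero]

theorem AristotelianFluid.alpha_v (F : AristotelianFluid I M k J) (ht : t ∈ J) (x : M) :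
    toCovector (V := E) (F.alpha t x) (F.v t x) = 0 := by
  rw [F.alpha_eq ht]
  exact (extD I (F.τ t) x).map_eq_zero_of_eq _ (i := 0) (j := 1) rfl (by simp)

theorem AristotelianFluid.contMDiff_log_speed (F : AristotelianFluid I M k J) (ht : t ∈ J) :
    ContMDiff I 𝓘(ℝ, ℝ) ∞ (fun x => Real.log (F.speed t x)) :=
  contMDiff_log (F.contMDiff_speed ht) fun x => (F.speed_pos ht x).ne'

theorem AristotelianFluid.smoothForm_alphaV (F : AristotelianFluid I M k J) (ht : t ∈ J) :
    SmoothForm I (F.alphaV t) :=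
  (F.smoothForm_alpha ht).sub (smoothForm_dFun (F.contMDiff_log_speed ht))

theorem AristotelianFluid.extD_vflat (F : AristotelianFluid I M k J) (ht : t ∈ J) :
    extD I (F.vflat t) = wedge (F.vflat t) (F.alphaV t) := by
  rw [F.vflat_eq ht, extD_fun_smul (F.contMDiff_speed ht) (F.smoothForm_τ ht), F.extD_τ ht]
  funext x
  have hs := (F.speed_pos ht x).ne'
  simp only [wedge, Pi.add_apply, AristotelianFluid.alphaV, Pi.sub_apply]
  rw [dFun_log (F.contMDiff_speed ht) (fun x => (F.speed_pos ht x).ne'), wedgePt_smul_left,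
    wedgePt_sub_right, wedgePt_smul_right, smul_sub, smul_smul, mul_inv_cancel₀ hs, one_smul,
    wedgePt_comm (F.τ t x) (dFun I _ x)]
  abel

end Fluid

/-! ### The Euler equation in terms of forms -/

section Dynamics

variable {E : Type*} [NormedAddCommGroup E] [NormedSpace ℝ E] [FiniteDimensional ℝ E]
  {H : Type*} [TopologicalSpace H] {I : ModelWithCorners ℝ E H}
  {M : Type*} [TopologicalSpace M] [ChartedSpace H M] [IsManifold I ∞ M] {k : ℕ} {J : Set ℝ}
  {t : ℝ}

omit [FiniteDimensional ℝ E] in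
/-- `(∇_X X)^♭ = ι_X dX^♭ + ½ d(g(X, X))`. -/
theorem IsLeviCivita.inner_conn_self {g : Metric I M}
    {conn : CovariantDerivative I E (TangentSpace I : M → Type _)} (h : IsLeviCivita g conn)
    {X : (x : M) → TangentSpace I x} (hX : SmoothForm I (flat g X)) {x : M}
    (hXx : DiffVectorAt X x) (u : TangentSpace I x) :
    g.inner x (conn X x (X x)) u
      = toCovector (V := E) (interiorProd I X (extD I (flat g X)) x) u
        + 2⁻¹ * mvfderiv I (fun y => g.inner y (X y) (X y)) x u := by
  let Y : (y : M) → TangentSpace I y := FiberBundle.extend E u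
  have hY : DiffVectorAt Y x := FiberBundle.mdifferentiableAt_extend I E u
  have hYx : Y x = u := FiberBundle.extend_apply_self (F := E) u
  have h1 := h.1 X Y x (X x) hXx hY
  have h2 := h.1 X X x u hXx hXx
  have h3 := h.2 X Y x hXx hY
  have h4 := extD_apply_eq_sub_mlieBracket hX hXx hY
  have h5 : toCovector (V := E) (flat g X x) (VectorField.mlieBracket I X Y x)
      = g.inner x (X x) (conn Y x (X x)) - g.inner x (X x) (conn X x u) := by
    rw [← h3, hYx]
    exact map_sub (g.inner x (X x)) _ _
  rw [hYx] at h1 h4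
  rw [g.symm x (conn X x u) (X x)] at h2
  have h6 : mvfderiv I (fun y => toCovector (V := E) (flat g X y) (Y y)) x (X x)
      = mvfderiv I (fun y => g.inner y (X y) (Y y)) x (X x) := rfl
  have h7 : mvfderiv I (fun y => toCovector (V := E) (flat g X y) (X y)) x u
      = mvfderiv I (fun y => g.inner y (X y) (X y)) x u := rfl
  rw [h5, h6, h7] at h4
  have h8 : toCovector (V := E) (interiorProd I X (extD I (flat g X)) x) u
      = toCovector (V := E) ((extD I (flat g X) x).curryLeft (X x)) u := rfl
  rw [h8]
  linarith

theorem IdealFluid.deriv_vflat (F : IdealFluid I M k J) (hJ : IsOpen J) (ht : t ∈ J) (x : M) :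
    deriv (fun s => F.vflat s x) t
      = ofCovector (V := E) (F.g.inner x (deriv (fun s => F.v s x) t)) := by
  let G : E →L[ℝ] E →L[ℝ] ℝ := F.g.inner x
  exact ((ofCovectorL ∘L G).hasFDerivAt.comp_hasDerivAt t
    (F.differentiableAt_v hJ ht x).hasDerivAt).deriv

theorem IdealFluid.contMDiff_p (F : IdealFluid I M k J) (ht : t ∈ J) :
    ContMDiff I 𝓘(ℝ, ℝ) ∞ (F.p t) :=
  contMDiff_slice F.p_smooth ht

/-- The Euler equation `∂v^♭/∂t + ι_v dv^♭ = -d(½ s_v + p)`. -/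
theorem IdealFluid.deriv_vflat_eq (F : IdealFluid I M k J) (hJ : IsOpen J) (ht : t ∈ J)
    (hF : SmoothForm I (F.vflat t)) :
    (fun x => deriv (fun s => F.vflat s x) t)
      = (-1 : ℝ) • (interiorProd I (F.v t) (extD I (F.vflat t))
        + ((2⁻¹ : ℝ) • dFun I (F.speed t) + dFun I (F.p t))) := by
  funext x
  rw [F.deriv_vflat hJ ht]
  apply toCovector_injective
  have key : ∀ u : TangentSpace I x, F.g.inner x (deriv (fun s => F.v s x) t) u
      = -1 * (toCovector (V := E) (interiorProd I (F.v t) (extD I (F.vflat t)) x) u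
        + (2⁻¹ * mvfderiv I (F.speed t) x u + mvfderiv I (F.p t) x u)) := fun u => by
    have h1 := congrArg (fun z => F.g.inner x z u) (F.euler t ht x)
    have h2 : F.g.inner x (sharp F.g x (mvfderiv I (F.p t) x)) = mvfderiv I (F.p t) x :=
      (flatEquiv F.g x).apply_symm_apply _
    have h3 := F.leviCivita.inner_conn_self hF (F.diffVectorAt_v ht x) u
    have h4 : F.g.inner x (deriv (fun s => F.v s x) t + F.conn (F.v t) x (F.v t x)) u
        = F.g.inner x (deriv (fun s => F.v s x) t) u
          + F.g.inner x (F.conn (F.v t) x (F.v t x)) u := by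
      rw [map_add]
      rfl
    have h5 : F.g.inner x (- sharp F.g x (mvfderiv I (F.p t) x)) u
        = - mvfderiv I (F.p t) x u := by
      rw [map_neg, h2]
      rfl
    simp only [h4, h5] at h1
    have h6 : toCovector (V := E) (interiorProd I (F.v t) (extD I (F.vflat t)) x) u
      = toCovector (V := E) (interiorProd I (F.v t) (extD I (flat F.g (F.v t))) x) u := rfl
    have h7 : mvfderiv I (F.speed t) x u
      = mvfderiv I (fun y => F.g.inner y (F.v t y) (F.v t y)) x u := rfl
    rw [h6, h7]
    linarith
  ext u
  exact key u

/-- The vorticity equation `d(ι_v dv^♭) = -∂(dv^♭)/∂t`. -/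
theorem IdealFluid.extD_interiorProd_extD_vflat (F : IdealFluid I M k J) (hJ : IsOpen J)
    (ht : t ∈ J) (hF : SmoothFormFamily I J F.vflat) :
    extD I (interiorProd I (F.v t) (extD I (F.vflat t)))
      = (-1 : ℝ) • fun x => deriv (fun s => extD I (F.vflat s) x) t := by
  have hη := hF.smoothForm ht
  have hA := hη.extD.interiorProd (F.contMDiff_v ht)
  have hs := smoothForm_dFun (F.contMDiff_speed ht)
  have hp := smoothForm_dFun (F.contMDiff_p ht)
  have h1 : (fun x => deriv (fun s => extD I (F.vflat s) x) t)
      = extD I (fun x => deriv (fun s => F.vflat s x) t) :=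
    funext fun x => (hF.extD_deriv hJ ht x).symm
  rw [h1, F.deriv_vflat_eq hJ ht hη, extD_smul, extD_add I hA ((hs.smul I _).add I hp),
    extD_add I (hs.smul I _) hp, extD_smul, extD_dFun (F.contMDiff_speed ht),
    extD_dFun (F.contMDiff_p ht), smul_smul]
  simp

omit [FiniteDimensional ℝ E] in
theorem SmoothMultivectorFamily.differentiableAt {ξ : ℝ → MultivectorField E M k}
    (hξ : SmoothMultivectorFamily I J ξ) (hJ : IsOpen J) (ht : t ∈ J) (x : M)
    (l : Module.Dual ℝ (⋀[ℝ]^k E)) : DifferentiableAt ℝ (fun s => l (ξ s x)) t := by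
  have h := ((hξ x l).hasDerivAt_left hJ ht (mem_extChartAt_target x)).differentiableAt
  simp only [extChartAt_to_inv] at h
  rw [tangentCoordChange_self_self] at h
  simpa [exteriorPower.map_id] using h

theorem deriv_contract {ξ : ℝ → MultivectorField E M k} {m : ℕ}
    (hξ : SmoothMultivectorFamily I J ξ) (hJ : IsOpen J) (ht : t ∈ J) (w : DForm E M (k + m))
    (x : M) :
    deriv (fun s => contractField (ξ s) w x) t = contractField (timeDerivMultivector ξ t) w x := by
  have h : (fun s => contractField (ξ s) w x) = fun s => ∑ i,
      (Module.finBasis ℝ (⋀[ℝ]^k E)).repr (ξ s x) i •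
        contract (Module.finBasis ℝ (⋀[ℝ]^k E) i) (w x) := by
    funext s
    rw [← contract_sum, Module.Basis.sum_repr]
    rfl
  have hd : ∀ i, DifferentiableAt ℝ
      (fun s => (Module.finBasis ℝ (⋀[ℝ]^k E)).repr (ξ s x) i) t := fun i =>
    hξ.differentiableAt hJ ht x ((Module.finBasis ℝ (⋀[ℝ]^k E)).coord i)
  rw [h, contractField, timeDerivMultivector, contract_sum]
  exact (HasDerivAt.fun_sum fun i _ => (hd i).hasDerivAt.smul_const _).deriv

theorem IdealFluid.IsVorticity.deriv_extD_vflat {F : IdealFluid I M k J}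
    {ξ : ℝ → MultivectorField E M k} (hξ : F.IsVorticity ξ) (hJ : IsOpen J) (ht : t ∈ J) :
    (fun x => deriv (fun s => extD I (F.vflat s) x) t)
      = contractField (timeDerivMultivector ξ t) F.μ := by
  funext x
  rw [← deriv_contract hξ.1 hJ ht]
  apply Filter.EventuallyEq.deriv_eq
  filter_upwards [hJ.mem_nhds ht] with s hs
  exact (congrFun (hξ.2 s hs) x).symm

end Dynamics

/-! ### The Godbillon-Vey class of an Aristotelian fluid -/

section FluidGodbillonVey

variable {E : Type*} [NormedAddCommGroup E] [NormedSpace ℝ E] [FiniteDimensional ℝ E]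
  {H : Type*} [TopologicalSpace H] {I : ModelWithCorners ℝ E H}
  {M : Type*} [TopologicalSpace M] [ChartedSpace H M] [IsManifold I ∞ M] {k : ℕ} {J : Set ℝ}
  {t : ℝ}

omit [FiniteDimensional ℝ E] in
theorem wedge_fun_smul_extD_fun_smul {f : M → ℝ} {B : DForm E M 1}
    (hf : ContMDiff I 𝓘(ℝ, ℝ) ∞ f) (hB : SmoothForm I B) :
    wedge (fun x => f x • B x) (extD I (fun x => f x • B x))
      = fun x => (f x ^ 2) • wedge B (extD I B) x := by
  rw [extD_fun_smul hf hB]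
  funext x
  simp only [wedge, Pi.add_apply, wedgePt_smul_left, wedgePt_add_right, wedgePt_smul_right]
  rw [wedgePt_cycle (B x), wedgePt_self, wedgePt_zero_right, smul_zero, zero_add, smul_smul, sq]

theorem AristotelianFluid.vflat_v (F : AristotelianFluid I M k J) (t : ℝ) (x : M) :
    toCovector (V := E) (F.vflat t x) (F.v t x) = F.speed t x := rfl

theorem AristotelianFluid.alphaV_v (F : AristotelianFluid I M k J) (ht : t ∈ J) (x : M) :
    toCovector (V := E) (F.alphaV t x) (F.v t x)
      = - ((F.speed t x)⁻¹ * lieFun I (F.v t) (F.speed t) x) := by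
  have h1 : toCovector (V := E) (F.alphaV t x) (F.v t x)
      = toCovector (V := E) (F.alpha t x) (F.v t x)
        - toCovector (V := E) (dFun I (fun x => Real.log (F.speed t x)) x) (F.v t x) := rfl
  rw [h1, F.alpha_v ht, dFun_log (F.contMDiff_speed ht) (fun x => (F.speed_pos ht x).ne'), zero_sub]
  rfl

theorem AristotelianFluid.contMDiff_lieFun_speed (F : AristotelianFluid I M k J) (ht : t ∈ J) :
    ContMDiff I 𝓘(ℝ, ℝ) ∞ (lieFun I (F.v t) (F.speed t)) :=
  (smoothForm_dFun (F.contMDiff_speed ht)).contMDiff_apply (F.contMDiff_v ht)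

theorem AristotelianFluid.contMDiff_inv_speed_sq_mul (F : AristotelianFluid I M k J)
    (ht : t ∈ J) : ContMDiff I 𝓘(ℝ, ℝ) ∞
      (fun x => (F.speed t x ^ 2)⁻¹ * lieFun I (F.v t) (F.speed t) x) :=
  (contMDiff_inv ((F.contMDiff_speed ht).pow 2)
    fun x => pow_ne_zero 2 (F.speed_pos ht x).ne').mul (F.contMDiff_lieFun_speed ht)

theorem AristotelianFluid.interiorProd_extD_vflat (F : AristotelianFluid I M k J) (ht : t ∈ J) :
    interiorProd I (F.v t) (extD I (F.vflat t)) = fun x => F.speed t x • (F.alphaV t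
      + fun x => ((F.speed t x ^ 2)⁻¹ * lieFun I (F.v t) (F.speed t) x) • F.vflat t x) x := by
  rw [F.extD_vflat ht, interiorProd_wedge_one]
  funext x
  have hs := (F.speed_pos ht x).ne'
  have h : F.speed t x * ((F.speed t x ^ 2)⁻¹ * lieFun I (F.v t) (F.speed t) x)
      = (F.speed t x)⁻¹ * lieFun I (F.v t) (F.speed t) x := by field_simp
  rw [F.vflat_v, F.alphaV_v ht, Pi.add_apply, smul_add, smul_smul, h]
  module

theorem AristotelianFluid.wedge_extD_alphaV (F : AristotelianFluid I M k J) (ht : t ∈ J) :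
    wedge (F.alphaV t) (extD I (F.alphaV t))
      = - extD I (fun x => ((F.speed t x ^ 2)⁻¹ * lieFun I (F.v t) (F.speed t) x) •
            extD I (F.vflat t) x)
        + fun x => (F.speed t x ^ 2)⁻¹ •
            wedge (interiorProd I (F.v t) (extD I (F.vflat t)))
              (extD I (interiorProd I (F.v t) (extD I (F.vflat t)))) x := by
  have hf := F.contMDiff_inv_speed_sq_mul ht
  have hη := F.smoothFormFamily_vflat.smoothForm ht
  have hα := F.smoothForm_alphaV ht
  have h := wedge_extD_add_smul hf hη hα (F.extD_vflat ht)
  rw [F.interiorProd_extD_vflat ht, wedge_fun_smul_extD_fun_smul (F.contMDiff_speed ht)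
    (hα.add I (hη.fun_smul hf)), h]
  funext x
  have hs := pow_ne_zero 2 (F.speed_pos ht x).ne'
  simp only [Pi.add_apply, Pi.neg_apply]
  rw [smul_smul, inv_mul_cancel₀ hs, one_smul]
  abel

theorem AristotelianFluid.wedge_extD_alphaV_mem_closedForms (F : AristotelianFluid I M k J)
    (ht : t ∈ J) : wedge (F.alphaV t) (extD I (F.alphaV t)) ∈ closedForms I M 3 ∧
      ∀ hcl, IsGodbillonVeyClass I (F.vflat t)
        (deRhamClass I (wedge (F.alphaV t) (extD I (F.alphaV t))) hcl) := by
  have hη := F.smoothFormFamily_vflat.smoothForm ht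
  have hα := F.smoothForm_alphaV ht
  let X : (x : M) → TangentSpace I x := fun x => (F.speed t x)⁻¹ • F.v t x
  have hX : ContMDiff I I.tangent ∞ (fun x => (⟨x, X x⟩ : TangentBundle I M)) :=
    ContMDiff.smul_section (contMDiff_inv (F.contMDiff_speed ht)
      fun x => (F.speed_pos ht x).ne') (F.contMDiff_v ht)
  have hηX : ∀ x, toCovector (V := E) (F.vflat t x) (X x) = 1 := fun x => by
    have h : toCovector (V := E) (F.vflat t x) (X x)
        = (F.speed t x)⁻¹ * toCovector (V := E) (F.vflat t x) (F.v t x) :=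
      map_smul (toCovector (V := E) (F.vflat t x)) _ _
    rw [h, F.vflat_v, inv_mul_cancel₀ (F.speed_pos ht x).ne']
  exact ⟨wedge_extD_mem_closedForms hη hα hηX (F.extD_vflat ht),
    isGodbillonVeyClass_deRhamClass hX hη hα hηX (F.extD_vflat ht)⟩

theorem AristotelianFluid.isGodbillonVeyClass_τ (F : AristotelianFluid I M k J) (ht : t ∈ J)
    (hcl : wedge (F.alphaV t) (extD I (F.alphaV t)) ∈ closedForms I M 3) :
    IsGodbillonVeyClass I (F.τ t)
      (deRhamClass I (wedge (F.alphaV t) (extD I (F.alphaV t))) hcl) := by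
  have hα := F.smoothForm_alpha ht
  have hσ := F.contMDiff_log_speed ht
  have hτ := F.smoothForm_τ ht
  have hclα := wedge_extD_mem_closedForms hτ hα (F.τ_v t ht) (F.extD_τ ht)
  have hd : extD I (F.alphaV t) = extD I (F.alpha t) := by
    rw [AristotelianFluid.alphaV, extD_sub hα (smoothForm_dFun hσ), extD_dFun hσ, sub_zero]
  have h : wedge (F.alpha t) (extD I (F.alpha t)) = wedge (F.alphaV t) (extD I (F.alphaV t))
      + extD I (fun x => Real.log (F.speed t x) • extD I (F.alpha t) x) := by
    rw [hd, extD_fun_smul hσ hα.extD, extD_extD hα]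
    funext x
    simp only [wedge, AristotelianFluid.alphaV, Pi.add_apply, Pi.sub_apply, wedgePt_sub_left,
      Pi.zero_apply, smul_zero, add_zero, sub_add_cancel]
  rw [deRhamClass_eq_of_eq_add_extD hcl hclα (hα.extD.fun_smul hσ) h]
  exact isGodbillonVeyClass_deRhamClass (F.contMDiff_v ht) hτ hα (F.τ_v t ht) (F.extD_τ ht) hclα

theorem IdealFluid.deriv_extD_vflat_eq_zero (F : IdealFluid I M k J) (hJ : IsOpen J) (ht : t ∈ J)
    (hF : SmoothFormFamily I J F.vflat) (hv : ∀ x, deriv (fun s => F.v s x) t = 0) :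
    (fun x => deriv (fun s => extD I (F.vflat s) x) t) = 0 := by
  have h : (fun x => deriv (fun s => F.vflat s x) t) = 0 := funext fun x => by
    rw [F.deriv_vflat hJ ht, hv x, map_zero]
    rfl
  funext x
  rw [← hF.extD_deriv hJ ht x, h, extD_zero]

end FluidGodbillonVey

end AristotelianHydro

theorem mainTheorem1
    {E : Type*} [NormedAddCommGroup E] [NormedSpace ℝ E] [FiniteDimensional ℝ E]
    {H : Type*} [TopologicalSpace H] (I : ModelWithCorners ℝ E H)
    {M : Type*} [TopologicalSpace M] [ChartedSpace H M] [IsManifold I ∞ M]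
    (k : ℕ) (hdim : Module.finrank ℝ E = k + 2)
    (J : Set ℝ) (hJ : IsOpen J)
    (F : AristotelianFluid I M k J)
    (ξ : ℝ → MultivectorField E M k) (hξ : F.IsVorticity ξ)
    (t : ℝ) (ht : t ∈ J) :
    (extD I (F.τ t) = wedge (F.τ t) (F.alpha t) ∧
      extD I (F.vflat t) = wedge (F.vflat t) (F.alphaV t)) ∧
    (∃ hcl : wedge (F.alphaV t) (extD I (F.alphaV t)) ∈ closedForms I M 3,
      IsGodbillonVeyClass I (F.τ t)
        (deRhamClass I (wedge (F.alphaV t) (extD I (F.alphaV t))) hcl) ∧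
      IsGodbillonVeyClass I (F.vflat t)
        (deRhamClass I (wedge (F.alphaV t) (extD I (F.alphaV t))) hcl)) ∧
    wedge (F.alphaV t) (extD I (F.alphaV t))
      = - extD I (fun x => ((F.speed t x ^ 2)⁻¹ * lieFun I (F.v t) (F.speed t) x) •
            contractField (ξ t) F.μ x)
        - (fun x => (F.speed t x ^ 2)⁻¹ •
            wedge (interiorProd I (F.v t) (contractField (ξ t) F.μ))
              (contractField (timeDerivMultivector ξ t) F.μ) x) ∧
    (lieFun I (F.v t) (F.speed t) = 0 →
      wedge (F.alphaV t) (extD I (F.alphaV t))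
        = - (fun x => (F.speed t x ^ 2)⁻¹ •
            wedge (interiorProd I (F.v t) (contractField (ξ t) F.μ))
              (contractField (timeDerivMultivector ξ t) F.μ) x) ∧
      (timeDerivMultivector ξ t = 0 → IsGodbillonVeyClass I (F.τ t) 0) ∧
      ((∀ x, deriv (fun s => F.v s x) t = 0) → IsGodbillonVeyClass I (F.τ t) 0)) := by
  have hω := hξ.2 t ht
  have hF := F.smoothFormFamily_vflat
  have hdt := hξ.deriv_extD_vflat hJ ht
  have hdA := F.extD_interiorProd_extD_vflat hJ ht hF
  rw [hdt] at hdA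
  have hcl := (F.wedge_extD_alphaV_mem_closedForms ht).1
  have hτ := F.isGodbillonVeyClass_τ ht hcl
  have hmain : wedge (F.alphaV t) (extD I (F.alphaV t))
      = - extD I (fun x => ((F.speed t x ^ 2)⁻¹ * lieFun I (F.v t) (F.speed t) x) •
            contractField (ξ t) F.μ x)
        - (fun x => (F.speed t x ^ 2)⁻¹ •
            wedge (interiorProd I (F.v t) (contractField (ξ t) F.μ))
              (contractField (timeDerivMultivector ξ t) F.μ) x) := by
    rw [F.wedge_extD_alphaV ht, hdA, hω]
    funext x
    simp only [wedge, Pi.add_apply, Pi.sub_apply, Pi.smul_apply, wedgePt_smul_right]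
    module
  refine ⟨⟨F.extD_τ ht, F.extD_vflat ht⟩,
    ⟨hcl, hτ, (F.wedge_extD_alphaV_mem_closedForms ht).2 hcl⟩, hmain, fun hL => ?_⟩
  have hsteady : wedge (F.alphaV t) (extD I (F.alphaV t))
        = - (fun x => (F.speed t x ^ 2)⁻¹ •
            wedge (interiorProd I (F.v t) (contractField (ξ t) F.μ))
              (contractField (timeDerivMultivector ξ t) F.μ) x) := by
    have h0 : (fun x => ((F.speed t x ^ 2)⁻¹ * lieFun I (F.v t) (F.speed t) x) •
        contractField (ξ t) F.μ x) = 0 := by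
      funext x
      simp [hL]
    rw [hmain, h0, extD_zero, neg_zero, zero_sub]
  have hzero : contractField (timeDerivMultivector ξ t) F.μ = 0 →
      IsGodbillonVeyClass I (F.τ t) 0 := fun h => by
    rw [← deRhamClass_eq_zero hcl]
    · exact hτ
    · rw [hsteady, h]
      funext x
      simp [wedge, wedgePt_zero_right]
  refine ⟨hsteady, fun h => hzero ?_, fun h => hzero ?_⟩
  · rw [h]
    exact funext fun x => contract_zero (F.μ x)
  · rw [← hdt]
    exact F.deriv_extD_vflat_eq_zero hJ ht hF h
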